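/- Let $X$ be a spindle, i.e. a set with an operation $(x,y)\mapsto x^y$ satisfying $(x^y)^z=(x^z)^{(y^z)}$ and $x^x=x$. Let $A=\mathbb Z M(X)$ be the monoid algebra of $M(X)=\langle X : yx^y=xy\rangle$, and let $$B=\mathbb Z\langle x,e_y : x,y\in X\rangle\big/\langle yx^y-xy,\ ye_{x^y}-e_xy\rangle ,$$ graded by $|x|=0$, $|e_x|=1$, with the derivation $d$ of degree $-1$ given by $d(x)=0$, $d(e_x)=1-x$; it is a differential graded $A$-bimodule. Let $B^+$ be its positive degree part, $B^D$ the two-sided ideal generated by all $e_x^2$, $B^Q=B/B^D$, and $B^N$ the left $A$-submodule generated by $1$ and all $(e_{x_1}-e_{x_2})\cdots(e_{x_{n-1}}-e_{x_n})e_{x_n}$, $n\ge 1$; it is a sub-bimodule. Let $B^L=B_1\otimes_A B^D$, with $b\otimes c$ of degree $1+|c|$. Let $s\colon B^+\to B^D$ replace, in every monomial, the first letter $e_y$ by $e_ye_y$. 1. The map $s$ is well defined, injective, $A$-bilinear and of degree $1$. Multiplication $b\otimes c\mapsto bc$ is injective on $B^L$ and identifies it, as a graded $A$-bimodule, with $B^+B^D\subseteq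 B^D$. With this identification, $B^D=B^L\oplus s((B^N)^+)$ as graded $A$-bimodules. Hence, for $n\ge 2$, the formula $(l,[b])\mapsto l+s(b)$, $b\in B^N_{n-1}$, defines an isomorphism of $A$-bimodules $$B^L_n\oplus B^Q_{n-1}\;\simeq\; B^D_n .$$ 2. For an $A$-bimodule $M$ put $\overline M=\mathbb Z\otimes_A M=M/\langle xm-m : x\in X, m\in M\rangle$, and write $\overline B{}^D,\overline B{}^L,\overline B{}^N,\overline B{}^Q$ accordingly, with the differential induced by $d$ on $\overline B$, $\overline B{}^D$ and $\overline B{}^Q=\overline B/\overline B{}^D$. Then $\overline B{}^D$ and $\overline B{}^L$ embed in $\overline B$, the subspaces $\overline B{}^L$ and $s((\overline B{}^N)^+)$ are subcomplexes, and, for $n\ge 2$, $$\overline B{}^L_n\oplus \overline B{}^Q_{n-1}\;\simeq\;\overline B{}^D_n ,\qquad (l,[b])\mapsto l+s(b)\quad (b\in\overline B{}^N_{n-1}),$$ is an isomorphism of differential graded $A$-bimodules, where the shifted complex $\overline B{}^Q_{\bullet-1}$ (in degrees $\bullet\ge 2$) carries the differential $-d$, as usual for a shift by one. 3. Let $C_n=\mathbb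 ZX^n$ be the rack complex, with $$\partial(x_1\cdots x_n)=\sum_{i=1}^n(-1)^{i-1}\bigl(x_1\cdots\widehat{x_i}\cdots x_n-x_1^{x_i}\cdots x_{i-1}^{x_i}x_{i+1}\cdots x_n\bigr),$$ let $C^D_n$ be spanned by the tuples with two equal neighbours, $C^L_n$ by those with two equal neighbours $x_i=x_{i+1}$ for some $i\ge 2$, and $C^Q=C/C^D$. The map $x_1\cdots x_n\mapsto[e_{x_1}\cdots e_{x_n}]$ is an isomorphism of complexes $C\simeq\overline B$; it carries $C^D$ onto $\overline B{}^D$ and $C^L$ onto $\overline B{}^L$, which are thus subcomplexes, and it transports the isomorphism of part 2 to the Litherland–Nelson isomorphism of complexes $C^D_\bullet\simeq C^L_\bullet\oplus C^Q_{\bullet-1}$ for $\bullet\ge 2$ (same sign convention). -/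

import Mathlib

open scoped TensorProduct

/-- A spindle: a self-distributive structure all of whose elements are idempotent.
In terms of `Shelf`, `Shelf.act y x` is the element usually written `x ◁ y` or `x ^ y`. -/
class Spindle (X : Type*) extends Shelf X where
  act_self : ∀ x : X, act x x = x

noncomputable section

namespace ShelfBialg

section Basic

variable (X : Type*) [Shelf X]

variable {X} in
/-- `rop x y` is the right self-distributive operation `x ◁ y = x ^ y`. -/
abbrev rop (x y : X) : X := Shelf.act y x

variable {X} in
lemma rop_rop (x y z : X) : rop (rop x y) z = rop (rop x z) (rop y z) :=
  Shelf.self_distrib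

/-! ### The structure monoid, the structure algebra and the algebra `B` -/

/-- The relations `y x^y = x y`. -/
inductive MRel : FreeMonoid X → FreeMonoid X → Prop
  | rel (x y : X) : MRel (FreeMonoid.of y * FreeMonoid.of (rop x y))
      (FreeMonoid.of x * FreeMonoid.of y)

/-- The structure monoid `M(X)`. -/
abbrev StrMonoid : Type _ := PresentedMonoid (MRel X)

/-- The structure algebra `A(X) = ℤ M(X)`. -/
def StrAlg : Type _ := MonoidAlgebra ℤ (StrMonoid X)

instance : Ring (StrAlg X) := inferInstanceAs (Ring (MonoidAlgebra ℤ (StrMonoid X)))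

/-- The relations `y x^y = x y` and `y e_{x^y} = e_x y`; the generator `x` is the letter `inl x`
and the generator `e_x` is the letter `inr x`. -/
inductive BRel : FreeAlgebra ℤ (X ⊕ X) → FreeAlgebra ℤ (X ⊕ X) → Prop
  | x (x y : X) : BRel
      (FreeAlgebra.ι ℤ (Sum.inl y) * FreeAlgebra.ι ℤ (Sum.inl (rop x y)))
      (FreeAlgebra.ι ℤ (Sum.inl x) * FreeAlgebra.ι ℤ (Sum.inl y))
  | e (x y : X) : BRel
      (FreeAlgebra.ι ℤ (Sum.inl y) * FreeAlgebra.ι ℤ (Sum.inr (rop x y)))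
      (FreeAlgebra.ι ℤ (Sum.inr x) * FreeAlgebra.ι ℤ (Sum.inl y))

/-- The algebra `B(X)`. -/
def B : Type _ := RingQuot (BRel X)

instance : Ring (B X) := inferInstanceAs (Ring (RingQuot (BRel X)))

variable {X}

/-- The image in `B(X)` of a letter. -/
def letter (c : X ⊕ X) : B X := RingQuot.mkRingHom (BRel X) (FreeAlgebra.ι ℤ c)

/-- The generator `x` of `B(X)`. -/
def gx (x : X) : B X := letter (Sum.inl x)

/-- The generator `e_x` of `B(X)`. -/
def ge (x : X) : B X := letter (Sum.inr x)

lemma gx_rel (x y : X) : gx y * gx (rop x y) = gx x * gx y := by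
  have h := RingQuot.mkRingHom_rel (BRel.x x y)
  rw [map_mul, map_mul] at h
  exact h

lemma ge_rel (x y : X) : gx y * ge (rop x y) = ge x * gx y := by
  have h := RingQuot.mkRingHom_rel (BRel.e x y)
  rw [map_mul, map_mul] at h
  exact h

/-- The universal property of `B(X)`. -/
def lift {R : Type*} [Ring R] (f g : X → R) (hf : ∀ x y, f y * f (rop x y) = f x * f y)
    (hg : ∀ x y, f y * g (rop x y) = g x * f y) : B X →+* R :=
  RingQuot.lift (r := BRel X) ⟨(FreeAlgebra.lift ℤ (Sum.elim f g)).toRingHom, by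
    intro a b h
    cases h with
    | x x y => simpa using hf x y
    | e x y => simpa using hg x y⟩

section lift

variable {R : Type*} [Ring R] (f g : X → R) (hf : ∀ x y, f y * f (rop x y) = f x * f y)
    (hg : ∀ x y, f y * g (rop x y) = g x * f y)

@[simp] lemma lift_gx (x : X) : lift f g hf hg (gx x) = f x := by
  refine (RingQuot.lift_mkRingHom_apply _ _ _).trans ?_
  simp

@[simp] lemma lift_ge (x : X) : lift f g hf hg (ge x) = g x := by
  refine (RingQuot.lift_mkRingHom_apply _ _ _).trans ?_
  simp

end lift

/-- The monomial of `B(X)` given by a word in the letters. -/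
def word (w : List (X ⊕ X)) : B X := (w.map letter).prod

/-- The degree of a word: `|x| = 0` and `|e_x| = 1`. -/
def deg (w : List (X ⊕ X)) : ℕ := w.countP Sum.isRight

@[simp] lemma word_nil : word ([] : List (X ⊕ X)) = 1 := rfl

@[simp] lemma word_inl (x : X) (w : List (X ⊕ X)) :
    word (Sum.inl x :: w) = gx x * word w := by simp [word, gx]

@[simp] lemma word_inr (x : X) (w : List (X ⊕ X)) :
    word (Sum.inr x :: w) = ge x * word w := by simp [word, ge]

lemma word_append (v w : List (X ⊕ X)) : word (v ++ w) = word v * word w := by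
  simp [word]

@[simp] lemma deg_nil : deg ([] : List (X ⊕ X)) = 0 := rfl

@[simp] lemma deg_inl (x : X) (w : List (X ⊕ X)) : deg (Sum.inl x :: w) = deg w := by
  simp [deg]

@[simp] lemma deg_inr (x : X) (w : List (X ⊕ X)) : deg (Sum.inr x :: w) = deg w + 1 :=
  List.countP_cons_of_pos rfl

lemma deg_append (v w : List (X ⊕ X)) : deg (v ++ w) = deg v + deg w := by
  simp [deg]

lemma word_span (b : B X) : b ∈ AddSubgroup.closure (Set.range (word (X := X))) := by
  obtain ⟨a, rfl⟩ := RingQuot.mkRingHom_surjective (BRel X) b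
  induction a using FreeAlgebra.induction with
  | grade0 r =>
    have h1 : RingQuot.mkRingHom (BRel X) (algebraMap ℤ _ r) = r • (word [] : B X) := by
      simp only [eq_intCast, map_intCast, word_nil, zsmul_eq_mul, mul_one]
      rfl
    rw [h1]
    exact AddSubgroup.zsmul_mem _ (AddSubgroup.subset_closure (Set.mem_range_self _)) r
  | grade1 c =>
    refine AddSubgroup.subset_closure ⟨[c], ?_⟩
    change ([letter c] : List (B X)).prod = _
    rw [List.prod_singleton]
    rfl
  | mul a b ha hb =>
    rw [map_mul]
    refine AddSubgroup.closure_induction₂ (p := fun u v _ _ =>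
      u * v ∈ AddSubgroup.closure (Set.range (word (X := X)))) ?_ ?_ ?_ ?_ ?_ ?_ ?_ ha hb
    · rintro _ _ ⟨u, rfl⟩ ⟨v, rfl⟩
      exact AddSubgroup.subset_closure ⟨u ++ v, word_append u v⟩
    · intro x _; rw [zero_mul]; exact zero_mem _
    · intro x _; rw [mul_zero]; exact zero_mem _
    · intro x y z _ _ _ h1 h2; rw [add_mul]; exact add_mem h1 h2
    · intro x y z _ _ _ h1 h2; rw [mul_add]; exact add_mem h1 h2
    · intro x y _ _ h1; rw [neg_mul]; exact neg_mem h1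
    · intro x y _ _ h1; rw [mul_neg]; exact neg_mem h1
  | add a b ha hb => rw [map_add]; exact add_mem ha hb

/-! ### `A(X)`-bimodules

An `A(X)`-bimodule is a left module over the enveloping ring `A ⊗ Aᵒᵖ`, where `a ⊗ a'` acts by
`m ↦ a m a'`. -/

variable (X) in
/-- The enveloping ring of `A(X)`. -/
def Env : Type _ := StrAlg X ⊗[ℤ] (StrAlg X)ᵐᵒᵖ

instance : Ring (Env X) := inferInstanceAs (Ring (StrAlg X ⊗[ℤ] (StrAlg X)ᵐᵒᵖ))

/-- The element `a ⊗ c` of the enveloping ring. -/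
def env (a c : StrAlg X) : Env X := a ⊗ₜ[ℤ] MulOpposite.op c

lemma env_one : env (1 : StrAlg X) 1 = 1 := rfl

lemma env_mul (a c a' c' : StrAlg X) : env a c * env a' c' = env (a * a') (c' * c) :=
  Algebra.TensorProduct.tmul_mul_tmul a a' (MulOpposite.op c) (MulOpposite.op c')

lemma env_induction {p : Env X → Prop} (r : Env X) (h0 : p 0) (h : ∀ a c, p (env a c))
    (hadd : ∀ r t, p r → p t → p (r + t)) : p r :=
  TensorProduct.induction_on (motive := p) r h0 (fun a c => h a c.unop) hadd

/-- The left action of `A(X)` on a bimodule. -/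
def lact {M : Type*} [AddCommGroup M] [Module (Env X) M] (a : StrAlg X) (m : M) : M :=
  env a 1 • m

/-- The right action of `A(X)` on a bimodule. -/
def ract {M : Type*} [AddCommGroup M] [Module (Env X) M] (m : M) (a : StrAlg X) : M :=
  env 1 a • m

/-- The generator `x` of `A(X)`. -/
def gA (x : X) : StrAlg X := MonoidAlgebra.of ℤ (StrMonoid X) (PresentedMonoid.of (MRel X) x)

/-- The algebra morphism `A(X) → B(X)`, `x ↦ x`. -/
def incl : StrAlg X →+* B X :=
  (MonoidAlgebra.lift ℤ (B X) (StrMonoid X) (PresentedMonoid.lift (gx (X := X)) (by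
    rintro a b ⟨x, y⟩
    simpa using gx_rel x y))).toRingHom

@[simp] lemma incl_gA (x : X) : incl (gA x) = gx x := by
  refine (MonoidAlgebra.lift_of _ _).trans ?_
  exact PresentedMonoid.lift_of _ _

lemma strAlg_induction {p : StrAlg X → Prop} (a : StrAlg X) (h1 : p 1)
    (hx : ∀ x a, p a → p (gA x * a)) (hadd : ∀ a b, p a → p b → p (a + b))
    (hneg : ∀ a, p a → p (-a)) : p a := by
  have h0 : p 0 := by simpa using hadd _ _ h1 (hneg _ h1)
  have hz : ∀ (r : ℤ) a, p a → p (r • a) := by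
    intro r a ha
    induction r using Int.induction_on with
    | zero => simpa using h0
    | succ n ih => rw [add_smul, one_smul]; exact hadd _ _ ih ha
    | pred n ih => rw [sub_smul, one_smul, sub_eq_add_neg]; exact hadd _ _ ih (hneg _ ha)
  refine MonoidAlgebra.induction_on (motive := p) a ?_ hadd hz
  intro m
  induction m using PresentedMonoid.inductionOn with
  | h w =>
    induction w using FreeMonoid.inductionOn' with
    | one => exact h1
    | of_mul x w ih =>
      have := hx x _ ih
      rw [map_mul, map_mul]
      exact this

/-- The left action of `A(X)` on `B(X)` by multiplication. -/
instance : Module (StrAlg X) (B X) := Module.compHom (B X) (incl (X := X))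

/-- The right action of `A(X)` on `B(X)` by multiplication. -/
instance : Module (StrAlg X)ᵐᵒᵖ (B X) := Module.compHom (B X) (incl (X := X)).op

lemma smul_def (a : StrAlg X) (b : B X) : a • b = incl a * b := rfl

lemma op_smul_def (a : StrAlg X) (b : B X) : MulOpposite.op a • b = b * incl a := rfl

instance : SMulCommClass (StrAlg X) (StrAlg X)ᵐᵒᵖ (B X) where
  smul_comm a c b := by
    obtain ⟨c, rfl⟩ := MulOpposite.op_surjective c
    simp only [smul_def, op_smul_def, mul_assoc]

attribute [local instance] TensorProduct.Algebra.module in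
/-- `B(X)` as an `A(X)`-bimodule. -/
instance : Module (Env X) (B X) :=
  inferInstanceAs (Module (StrAlg X ⊗[ℤ] (StrAlg X)ᵐᵒᵖ) (B X))

lemma env_smul (a c : StrAlg X) (b : B X) : env a c • b = incl a * b * incl c := by
  rw [mul_assoc]
  exact TensorProduct.Algebra.smul_def a (MulOpposite.op c) b

@[simp] lemma lact_B (a : StrAlg X) (b : B X) : lact a b = incl a * b := by
  rw [lact, env_smul, map_one, mul_one]

@[simp] lemma ract_B (b : B X) (a : StrAlg X) : ract b a = b * incl a := by
  rw [ract, env_smul, map_one, one_mul]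

/-- An additive subgroup of `B(X)` stable under left and right multiplication by all `x ∈ X`, as a
sub-`A(X)`-bimodule. -/
def subBimod (S : AddSubgroup (B X)) (hl : ∀ x, ∀ b ∈ S, gx x * b ∈ S)
    (hr : ∀ x, ∀ b ∈ S, b * gx x ∈ S) : Submodule (Env X) (B X) where
  toAddSubmonoid := S.toAddSubmonoid
  smul_mem' := by
    have hL : ∀ a, ∀ b ∈ S, incl a * b ∈ S := by
      intro a b hb
      induction a using strAlg_induction with
      | h1 => simpa using hb
      | hx x a ih => rw [map_mul, incl_gA, mul_assoc]; exact hl x _ ih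
      | hadd a b ha hb => rw [map_add, add_mul]; exact add_mem ha hb
      | hneg a ha => rw [map_neg, neg_mul]; exact neg_mem ha
    have hR : ∀ a, ∀ b ∈ S, b * incl a ∈ S := by
      intro a b hb
      induction a using strAlg_induction generalizing b with
      | h1 => simpa using hb
      | hx x a ih => rw [map_mul, incl_gA, ← mul_assoc]; exact ih _ (hr x _ hb)
      | hadd a c ha hc => rw [map_add, mul_add]; exact add_mem (ha _ hb) (hc _ hb)
      | hneg a ha => rw [map_neg, mul_neg]; exact neg_mem (ha _ hb)
    intro r b hb
    change r • b ∈ S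
    replace hb : b ∈ S := hb
    induction r using env_induction with
    | h0 => rw [zero_smul]; exact zero_mem _
    | h a c => rw [env_smul]; exact hR _ _ (hL _ _ hb)
    | hadd r t h1 h2 => rw [add_smul]; exact add_mem h1 h2

@[simp] lemma mem_subBimod {S : AddSubgroup (B X)} {hl hr} {b : B X} :
    b ∈ subBimod S hl hr ↔ b ∈ S := Iff.rfl

lemma gx_mul_mem (P : Submodule (Env X) (B X)) (x : X) {b : B X} (hb : b ∈ P) :
    gx x * b ∈ P := by
  have := P.smul_mem (env (gA x) 1) hb
  rwa [env_smul, incl_gA, map_one, mul_one] at this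

/-- A closure of a set stable under an additive map is stable under it. -/
lemma closure_stable {S : Set (B X)} (f : B X →+ B X)
    (h : ∀ b ∈ S, f b ∈ AddSubgroup.closure S) :
    ∀ b ∈ AddSubgroup.closure S, f b ∈ AddSubgroup.closure S := by
  intro b hb
  have : AddSubgroup.closure S ≤ (AddSubgroup.closure S).comap f :=
    (AddSubgroup.closure_le _).2 h
  exact this hb

/-! ### Grading, degenerate part, complement -/

variable (X) in
/-- The degree `n` part `B_n`: the span of the monomials of degree `n`. -/
def gr (n : ℕ) : Submodule (Env X) (B X) :=
  subBimod (AddSubgroup.closure {b | ∃ w, deg w = n ∧ b = word w})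
    (fun x => closure_stable (AddMonoidHom.mulLeft (gx x)) (by
      rintro _ ⟨w, hw, rfl⟩
      exact AddSubgroup.subset_closure ⟨Sum.inl x :: w, by simpa using hw, by simp⟩))
    (fun x => closure_stable (AddMonoidHom.mulRight (gx x)) (by
      rintro _ ⟨w, hw, rfl⟩
      exact AddSubgroup.subset_closure ⟨w ++ [Sum.inl x], by simpa [deg_append] using hw,
        by simp [word_append]⟩))

variable (X) in
/-- The positive degree part `B⁺`. -/
def pos : Submodule (Env X) (B X) := ⨆ n : ℕ, gr X (n + 1)

variable (X) in
/-- The degenerate part `B^D`: the two-sided ideal generated by the `e_x²`. -/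
def degen : Submodule (Env X) (B X) :=
  subBimod (AddSubgroup.closure {b | ∃ u x v, b = u * (ge x * ge x) * v})
    (fun x => closure_stable (AddMonoidHom.mulLeft (gx x)) (by
      rintro _ ⟨u, y, v, rfl⟩
      exact AddSubgroup.subset_closure ⟨gx x * u, y, v, by simp [mul_assoc]⟩))
    (fun x => closure_stable (AddMonoidHom.mulRight (gx x)) (by
      rintro _ ⟨u, y, v, rfl⟩
      exact AddSubgroup.subset_closure ⟨u, y, v * gx x, by simp [mul_assoc]⟩))

/-- `(e_{x₁} - e_{x₂}) ⋯ (e_{xₙ₋₁} - e_{xₙ}) e_{xₙ}`, and `1` for the empty list. -/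
def diffWord : List X → B X
  | [] => 1
  | [x] => ge x
  | x :: y :: l => (ge x - ge y) * diffWord (y :: l)

lemma diffWord_mul_gx (y : X) : ∀ l : List X,
    diffWord l * gx y = gx y * diffWord (l.map fun x => rop x y)
  | [] => by simp [diffWord]
  | [x] => by simpa [diffWord] using (ge_rel x y).symm
  | x :: z :: l => by
    have ih := diffWord_mul_gx y (z :: l)
    simp only [List.map_cons] at ih
    simp only [diffWord, List.map_cons]
    rw [mul_assoc, ih, ← mul_assoc, sub_mul, ← ge_rel, ← ge_rel, ← mul_sub, mul_assoc]

variable (X) in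
/-- The complement `B^N`: the left sub-`A(X)`-module generated by the elements `diffWord l`; it
is stable under the right action. -/
def BN : Submodule (Env X) (B X) :=
  subBimod (AddSubgroup.closure {b | ∃ a l, b = incl a * diffWord l})
    (fun x => closure_stable (AddMonoidHom.mulLeft (gx x)) (by
      rintro _ ⟨a, l, rfl⟩
      exact AddSubgroup.subset_closure ⟨gA x * a, l, by simp [mul_assoc]⟩))
    (fun x => closure_stable (AddMonoidHom.mulRight (gx x)) (by
      rintro _ ⟨a, l, rfl⟩
      refine AddSubgroup.subset_closure ⟨a * gA x, l.map fun z => rop z x, ?_⟩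
      simp [mul_assoc, diffWord_mul_gx]))

variable (X) in
/-- `B^D_n`. -/
abbrev DGr (n : ℕ) : Submodule (Env X) (B X) := degen X ⊓ gr X n

variable (X) in
/-- `B^N_n`. -/
abbrev NGr (n : ℕ) : Submodule (Env X) (B X) := BN X ⊓ gr X n

variable (X) in
/-- `B^Q_n = B_n / B^D_n`, where `B^Q = B / B^D`. -/
abbrev QGr (n : ℕ) : Type _ := gr X n ⧸ (DGr X n).submoduleOf (gr X n)

/-! ### The differential and the degeneracy

Both are upper right corners of a morphism from `B(X)` to upper triangular matrices, sending `x` to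
the diagonal matrix with entries `x, x`, and `e_x` to the matrix with rows `(p x, q x)` and
`(0, e_x)`. -/

section corner

variable (p q : X → B X) (hp : ∀ x y, gx y * p (rop x y) = p x * gx y)
  (hq : ∀ x y, gx y * q (rop x y) = q x * gx y)

/-- The morphism to triangular matrices. -/
def triHom : B X →+* Matrix (Fin 2) (Fin 2) (B X) :=
  lift (fun x => !![gx x, 0; 0, gx x]) (fun x => !![p x, q x; 0, ge x])
    (fun x y => by simp [gx_rel])
    (fun x y => by simp [ge_rel, hp, hq])

lemma triHom_incl (a : StrAlg X) : triHom p q hp hq (incl a) = !![incl a, 0; 0, incl a] := by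
  induction a using strAlg_induction with
  | h1 => simp [Matrix.one_fin_two]
  | hx x a ih =>
    have hx : triHom p q hp hq (gx x) = !![gx x, 0; 0, gx x] := by simp [triHom]
    rw [map_mul, map_mul, ih, incl_gA, hx, Matrix.mul_fin_two]
    simp
  | hadd a b ha hb => simp [ha, hb]
  | hneg a ha => simp [ha]

lemma triHom_gx_mul (x : X) (b : B X) (i j : Fin 2) :
    triHom p q hp hq (gx x * b) i j = gx x * triHom p q hp hq b i j := by
  rw [map_mul, Matrix.mul_apply]
  fin_cases i <;> simp [triHom]

lemma triHom_ge_mul_zero (x : X) (b : B X) (j : Fin 2) :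
    triHom p q hp hq (ge x * b) 0 j =
      p x * triHom p q hp hq b 0 j + q x * triHom p q hp hq b 1 j := by
  rw [map_mul, Matrix.mul_apply]
  simp [triHom]

lemma triHom_ge_mul_one (x : X) (b : B X) (j : Fin 2) :
    triHom p q hp hq (ge x * b) 1 j = ge x * triHom p q hp hq b 1 j := by
  rw [map_mul, Matrix.mul_apply]
  simp [triHom]

lemma triHom_one_one (b : B X) : triHom p q hp hq b 1 1 = b := by
  refine AddSubgroup.closure_induction (p := fun b _ => triHom p q hp hq b 1 1 = b)
    ?_ (by simp) (fun x y _ _ h1 h2 => by simp [h1, h2]) (fun x _ h => by simp [h]) (word_span b)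
  rintro _ ⟨w, rfl⟩
  induction w with
  | nil => simp
  | cons c w ih =>
    cases c with
    | inl x => simp [triHom_gx_mul, ih]
    | inr x => simp [triHom_ge_mul_one, ih]

/-- The upper right corner, as a morphism of bimodules. -/
def corner : B X →ₗ[Env X] B X where
  toFun b := triHom p q hp hq b 0 1
  map_add' a b := by simp
  map_smul' r b := by
    change triHom p q hp hq (r • b) 0 1 = r • triHom p q hp hq b 0 1
    induction r using env_induction with
    | h0 => simp only [zero_smul, map_zero, Matrix.zero_apply]
    | h a c =>
      simp only [env_smul, map_mul, triHom_incl]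
      simp only [Matrix.mul_apply, Fin.sum_univ_two]
      simp
    | hadd r t hr ht =>
      simp only [add_smul, map_add, Matrix.add_apply, hr, ht]

lemma corner_one : corner p q hp hq 1 = 0 := by simp [corner]

lemma corner_gx_mul (x : X) (b : B X) :
    corner p q hp hq (gx x * b) = gx x * corner p q hp hq b := triHom_gx_mul ..

lemma corner_ge_mul (x : X) (b : B X) :
    corner p q hp hq (ge x * b) = p x * corner p q hp hq b + q x * b := by
  refine (triHom_ge_mul_zero ..).trans ?_
  rw [triHom_one_one]
  rfl

end corner

variable (X) in
/-- The differential of `B(X)`: the derivation with `d x = 0` and `d e_x = 1 - x`. -/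
def d : B X →ₗ[Env X] B X :=
  corner (fun x => -ge x) (fun x => 1 - gx x)
    (fun x y => by simp [ge_rel])
    (fun x y => by rw [mul_sub, sub_mul, gx_rel, mul_one, one_mul])

variable (X) in
/-- The degeneracy: in a monomial, the first letter `e_y` is replaced by `e_y e_y`. It is
extended by `0` to degree `0`. -/
def s : B X →ₗ[Env X] B X :=
  corner (fun _ => 0) (fun x => ge x * ge x)
    (fun x y => by simp)
    (fun x y => by rw [← mul_assoc, ge_rel, mul_assoc, ge_rel, mul_assoc])

@[simp] lemma d_one : d X 1 = 0 := corner_one ..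

@[simp] lemma d_gx_mul (x : X) (b : B X) : d X (gx x * b) = gx x * d X b := corner_gx_mul ..

@[simp] lemma d_ge_mul (x : X) (b : B X) :
    d X (ge x * b) = (1 - gx x) * b - ge x * d X b := by
  refine (corner_ge_mul ..).trans ?_
  change -ge x * d X b + _ = _
  rw [neg_mul, neg_add_eq_sub]

lemma d_gx (x : X) : d X (gx x) = 0 := by simpa using d_gx_mul x 1

lemma d_ge (x : X) : d X (ge x) = 1 - gx x := by simpa using d_ge_mul x 1

@[simp] lemma s_one : s X 1 = 0 := corner_one ..

@[simp] lemma s_gx_mul (x : X) (b : B X) : s X (gx x * b) = gx x * s X b := corner_gx_mul ..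

@[simp] lemma s_ge_mul (x : X) (b : B X) : s X (ge x * b) = ge x * ge x * b := by
  refine (corner_ge_mul ..).trans ?_
  rw [zero_mul, zero_add]

lemma d_word_mul (w : List (X ⊕ X)) (b : B X) :
    d X (word w * b) = d X (word w) * b + (-1) ^ deg w * word w * d X b := by
  induction w with
  | nil => simp
  | cons c w ih =>
    cases c with
    | inl x =>
      have h : gx x * (-1) ^ deg w = (-1) ^ deg w * gx x :=
        ((Commute.neg_one_right (gx x)).pow_right _).eq
      simp only [word_inl, mul_assoc, d_gx_mul, deg_inl, ih, mul_add]
      rw [← mul_assoc (gx x) ((-1) ^ deg w), h, mul_assoc]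
    | inr x =>
      have h : ge x * (-1) ^ deg w = (-1) ^ deg w * ge x :=
        ((Commute.neg_one_right (ge x)).pow_right _).eq
      simp only [word_inr, mul_assoc, d_ge_mul, deg_inr, ih, mul_add, sub_mul, one_mul, pow_succ,
        neg_mul, mul_neg]
      rw [← mul_assoc (ge x) ((-1) ^ deg w), h, mul_assoc]
      abel

/-- The graded Leibniz rule. -/
lemma d_mul {n : ℕ} {a : B X} (ha : a ∈ gr X n) (b : B X) :
    d X (a * b) = d X a * b + (-1) ^ n * a * d X b := by
  refine AddSubgroup.closure_induction (p := fun a _ =>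
    d X (a * b) = d X a * b + (-1) ^ n * a * d X b) ?_ (by simp) ?_ ?_ ha
  · rintro _ ⟨w, rfl, rfl⟩
    exact d_word_mul w b
  · intro x y _ _ h1 h2
    rw [add_mul, map_add, map_add, h1, h2]
    noncomm_ring
  · intro x _ h
    rw [neg_mul, map_neg, map_neg, h]
    noncomm_ring

lemma d_d (b : B X) : d X (d X b) = 0 := by
  refine AddSubgroup.closure_induction (p := fun b _ => d X (d X b) = 0)
    ?_ (by simp) (fun x y _ _ h1 h2 => by simp [h1, h2]) (fun x _ h => by simp [h]) (word_span b)
  rintro _ ⟨w, rfl⟩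
  induction w with
  | nil => simp
  | cons c w ih =>
    cases c with
    | inl x => simp [ih]
    | inr x => simp [ih, sub_mul]

lemma word_mem_gr (w : List (X ⊕ X)) : word w ∈ gr X (deg w) :=
  AddSubgroup.subset_closure ⟨w, rfl, rfl⟩

lemma ge_mul_mem_gr (x : X) {n : ℕ} {b : B X} (hb : b ∈ gr X n) : ge x * b ∈ gr X (n + 1) := by
  have : (AddSubgroup.closure {b | ∃ w, deg w = n ∧ b = word w} : AddSubgroup (B X)) ≤
      (gr X (n + 1)).toAddSubgroup.comap (AddMonoidHom.mulLeft (ge x)) := by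
    refine (AddSubgroup.closure_le _).2 ?_
    rintro _ ⟨w, rfl, rfl⟩
    have := word_mem_gr (Sum.inr x :: w)
    rwa [deg_inr, word_inr] at this
  exact this hb

lemma d_word_mem (w : List (X ⊕ X)) :
    (deg w = 0 → d X (word w) = 0) ∧ ∀ n, deg w = n + 1 → d X (word w) ∈ gr X n := by
  induction w with
  | nil => simp
  | cons c w ih =>
    cases c with
    | inl x =>
      refine ⟨fun h => ?_, fun n h => ?_⟩
      · rw [word_inl, d_gx_mul, ih.1 (by simpa using h), mul_zero]
      · rw [word_inl, d_gx_mul]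
        exact gx_mul_mem _ _ (ih.2 n (by simpa using h))
    | inr x =>
      refine ⟨fun h => by simp at h, fun n h => ?_⟩
      obtain rfl : deg w = n := by simpa using h
      rw [word_inr, d_ge_mul, sub_mul, one_mul]
      refine sub_mem (sub_mem (word_mem_gr w) (gx_mul_mem _ _ (word_mem_gr w))) ?_
      rcases hn : deg w with _ | m
      · rw [ih.1 hn, mul_zero]; exact zero_mem _
      · exact ge_mul_mem_gr x (ih.2 m hn)

/-- The differential lowers the degree by one. -/
lemma d_mem_gr {n : ℕ} {b : B X} (hb : b ∈ gr X (n + 1)) : d X b ∈ gr X n := by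
  have : (AddSubgroup.closure {b | ∃ w, deg w = n + 1 ∧ b = word w} : AddSubgroup (B X)) ≤
      (gr X n).toAddSubgroup.comap (d X).toAddMonoidHom := by
    refine (AddSubgroup.closure_le _).2 ?_
    rintro _ ⟨w, hw, rfl⟩
    exact (d_word_mem w).2 n hw
  exact this hb

/-! ### The tensor product over `A(X)` and the late degenerate part -/

section tensor

variable (M N : Type*) [AddCommGroup M] [AddCommGroup N] [Module (Env X) M] [Module (Env X) N]

variable (X) in
/-- The relations `m a ⊗ n = m ⊗ a n`. -/
def balanced : AddSubgroup (M ⊗[ℤ] N) :=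
  AddSubgroup.closure {t | ∃ (m : M) (a : StrAlg X) (n : N),
    t = ract m a ⊗ₜ[ℤ] n - m ⊗ₜ[ℤ] lact a n}

variable (X) in
/-- The tensor product `M ⊗_A N` of two `A(X)`-bimodules. -/
def TensorA : Type _ := (M ⊗[ℤ] N) ⧸ balanced X M N

instance : AddCommGroup (TensorA X M N) :=
  inferInstanceAs (AddCommGroup ((M ⊗[ℤ] N) ⧸ balanced X M N))

variable {M N}

/-- The class of `m ⊗ n` in `M ⊗_A N`. -/
def tmulA (m : M) (n : N) : TensorA X M N := QuotientAddGroup.mk' (balanced X M N) (m ⊗ₜ[ℤ] n)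

/-- Biadditive maps `f` with `f (m a) n = f m (a n)` induce maps on `M ⊗_A N`. -/
def TensorA.lift {P : Type*} [AddCommGroup P] (f : M →+ N →+ P)
    (hf : ∀ m (a : StrAlg X) n, f (ract m a) n = f m (lact a n)) : TensorA X M N →+ P :=
  QuotientAddGroup.lift (balanced X M N)
    (TensorProduct.liftAddHom f (fun r m n => by simp)) (by
      refine (AddSubgroup.closure_le _).2 ?_
      rintro _ ⟨m, a, n, rfl⟩
      simp [hf])

@[simp] lemma TensorA.lift_tmulA {P : Type*} [AddCommGroup P] (f : M →+ N →+ P)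
    (hf : ∀ m (a : StrAlg X) n, f (ract m a) n = f m (lact a n)) (m : M) (n : N) :
    TensorA.lift f hf (tmulA m n) = f m n := rfl

lemma TensorA.hom_ext {P : Type*} [AddCommGroup P] {f g : TensorA X M N →+ P}
    (h : ∀ m n, f (tmulA m n) = g (tmulA m n)) : f = g := by
  refine QuotientAddGroup.addMonoidHom_ext _ ?_
  ext t
  induction t using TensorProduct.induction_on with
  | zero => simp
  | tmul m n => exact h m n
  | add t u ht hu => rw [map_add, map_add, ht, hu]

lemma tmulA_add_left (m m' : M) (n : N) :
    tmulA (X := X) (m + m') n = tmulA m n + tmulA m' n := by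
  simp only [tmulA, TensorProduct.add_tmul, map_add]
  rfl

lemma tmulA_add_right (m : M) (n n' : N) :
    tmulA (X := X) m (n + n') = tmulA m n + tmulA m n' := by
  simp only [tmulA, TensorProduct.tmul_add, map_add]
  rfl

lemma tmulA_ract (m : M) (a : StrAlg X) (n : N) :
    tmulA (X := X) (ract m a) n = tmulA m (lact a n) := by
  refine sub_eq_zero.1 ?_
  refine (map_sub (QuotientAddGroup.mk' (balanced X M N)) _ _).symm.trans ?_
  exact (QuotientAddGroup.eq_zero_iff _).2 (AddSubgroup.subset_closure ⟨m, a, n, rfl⟩)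

lemma lact_ract (a c : StrAlg X) (m : M) : lact a (ract m c) = ract (lact a m) c := by
  simp only [lact, ract, smul_smul, env_mul, one_mul, mul_one]

lemma lact_mul (a c : StrAlg X) (m : M) : lact (a * c) m = lact a (lact c m) := by
  simp only [lact, smul_smul, env_mul, mul_one]

lemma ract_mul (a c : StrAlg X) (m : M) : ract m (a * c) = ract (ract m a) c := by
  simp only [ract, smul_smul, env_mul, mul_one]

lemma lact_one (m : M) : lact (1 : StrAlg X) m = m := by rw [lact, env_one, one_smul]

lemma ract_one (m : M) : ract m (1 : StrAlg X) = m := by rw [ract, env_one, one_smul]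

lemma lact_add (a : StrAlg X) (m m' : M) : lact a (m + m') = lact a m + lact a m' := smul_add ..

lemma ract_add (a : StrAlg X) (m m' : M) : ract (m + m') a = ract m a + ract m' a := smul_add ..

lemma env_eq (a c : StrAlg X) : env a c = env a 1 * env 1 c := by
  rw [env_mul, mul_one, mul_one]

lemma env_add_left (a a' c : StrAlg X) : env (a + a') c = env a c + env a' c :=
  TensorProduct.add_tmul ..

lemma env_add_right (a c c' : StrAlg X) : env a (c + c') = env a c + env a c' :=
  TensorProduct.tmul_add ..

lemma add_lact (a a' : StrAlg X) (m : M) : lact (a + a') m = lact a m + lact a' m := by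
  simp only [lact, env_add_left, add_smul]

lemma ract_addR (a a' : StrAlg X) (m : M) : ract m (a + a') = ract m a + ract m a' := by
  simp only [ract, env_add_right, add_smul]

/-- The endomorphism `m ⊗ n ↦ a m ⊗ n c` of `M ⊗_A N`. -/
def tact (a c : StrAlg X) : TensorA X M N →+ TensorA X M N :=
  TensorA.lift
    (AddMonoidHom.mk' (fun m => AddMonoidHom.mk' (fun n => tmulA (lact a m) (ract n c))
        (fun n n' => by rw [ract_add, tmulA_add_right]))
      (fun m m' => by ext n; simp [lact_add, tmulA_add_left]))
    (fun m a' n => by simp [lact_ract, tmulA_ract])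

@[simp] lemma tact_tmulA (a c : StrAlg X) (m : M) (n : N) :
    tact a c (tmulA m n) = tmulA (X := X) (lact a m) (ract n c) := rfl

lemma tact_mul (a c a' c' : StrAlg X) :
    (tact (a * a') (c' * c) : TensorA X M N →+ TensorA X M N) = (tact a c).comp (tact a' c') :=
  TensorA.hom_ext fun m n => by simp [lact_mul, ract_mul]

lemma tact_one : (tact 1 1 : TensorA X M N →+ TensorA X M N) = AddMonoidHom.id _ :=
  TensorA.hom_ext fun m n => by simp [lact_one, ract_one]

lemma tact_add_left (a a' c : StrAlg X) :
    (tact (a + a') c : TensorA X M N →+ TensorA X M N) = tact a c + tact a' c :=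
  TensorA.hom_ext fun m n => by simp [add_lact, tmulA_add_left]

lemma tact_add_right (a c c' : StrAlg X) :
    (tact a (c + c') : TensorA X M N →+ TensorA X M N) = tact a c + tact a c' :=
  TensorA.hom_ext fun m n => by simp [ract_addR, tmulA_add_right]

/-- The left action on `M ⊗_A N`. -/
def tactL : StrAlg X →+* AddMonoid.End (TensorA X M N) :=
  RingHom.mk' ⟨⟨fun a => tact a 1, tact_one⟩, fun a b => by
      have h := tact_mul (M := M) (N := N) a 1 b 1
      rw [mul_one] at h
      exact h⟩
    (fun a b => tact_add_left a b 1)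

/-- The right action on `M ⊗_A N`. -/
def tactR : (StrAlg X)ᵐᵒᵖ →+* AddMonoid.End (TensorA X M N) :=
  RingHom.mk' ⟨⟨fun a => tact 1 a.unop, tact_one⟩, fun a b => by
      have h := tact_mul (M := M) (N := N) 1 a.unop 1 b.unop
      rw [mul_one] at h
      exact h⟩
    (fun a b => tact_add_right 1 a.unop b.unop)

/-- The enveloping ring acting on `M ⊗_A N`. -/
def tactHom : Env X →+* AddMonoid.End (TensorA X M N) :=
  (Algebra.TensorProduct.lift (R := ℤ) (S := ℤ) (A := StrAlg X) (B := (StrAlg X)ᵐᵒᵖ)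
    (C := AddMonoid.End (TensorA X M N)) (RingHom.toIntAlgHom tactL) (RingHom.toIntAlgHom tactR)
    (fun a b => by
      have h1 := tact_mul (M := M) (N := N) a 1 1 b.unop
      have h2 := tact_mul (M := M) (N := N) 1 b.unop a 1
      simp only [mul_one, one_mul] at h1 h2
      exact h1.symm.trans h2)).toRingHom

/-- `M ⊗_A N` as an `A(X)`-bimodule: `a (m ⊗ n) c = a m ⊗ n c`. -/
instance : Module (Env X) (TensorA X M N) := Module.compHom (TensorA X M N) (tactHom (X := X) (M := M) (N := N))

lemma env_smul_tmulA (a c : StrAlg X) (m : M) (n : N) :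
    env a c • tmulA (X := X) m n = tmulA (lact a m) (ract n c) := by
  have h1 := tact_mul (M := M) (N := N) a 1 1 c
  simp only [mul_one] at h1
  have h : tactHom (M := M) (N := N) (env a c) = tact a c :=
    (Algebra.TensorProduct.lift_tmul ..).trans h1.symm
  change tactHom (M := M) (N := N) (env a c) (tmulA m n) = _
  rw [h]
  exact tact_tmulA ..

end tensor

variable (X) in
/-- The late degenerate part `B^L = B_1 ⊗_A B^D`. -/
abbrev BL : Type _ := TensorA X (gr X 1) (degen X)

variable (X) in
/-- `B^L_n`, spanned by the `b ⊗ c` with `b` of degree `1` and `c` of degree `n - 1`. -/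
def LGr (n : ℕ) : Submodule (Env X) (BL X) :=
  Submodule.span (Env X) {t | ∃ (b : gr X 1) (c : degen X) (m : ℕ),
    m + 1 = n ∧ (c : B X) ∈ gr X m ∧ t = tmulA b c}

lemma coe_lact (P : Submodule (Env X) (B X)) (a : StrAlg X) (b : P) :
    ((lact a b : P) : B X) = incl a * b :=
  lact_B a (b : B X)

lemma coe_ract (P : Submodule (Env X) (B X)) (a : StrAlg X) (b : P) :
    ((ract b a : P) : B X) = b * incl a :=
  ract_B (b : B X) a

variable (X) in
/-- The additive map underlying `mulMap`. -/
def mulAdd : BL X →+ B X :=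
  TensorA.lift
    (AddMonoidHom.mk' (fun b : gr X 1 => AddMonoidHom.mk' (fun c : degen X => (b * c : B X))
        (fun c c' => by simp [mul_add]))
      (fun b b' => by ext c; simp [add_mul]))
    (fun b a c => by simp [coe_lact, coe_ract, mul_assoc])

lemma mulAdd_tmulA (b : gr X 1) (c : degen X) : mulAdd X (tmulA b c) = (b * c : B X) := rfl

variable (X) in
/-- The multiplication map `B^L → B`, `b ⊗ c ↦ b c`. -/
def mulMap : BL X →ₗ[Env X] B X where
  toFun := mulAdd X
  map_add' t u := map_add _ t u
  map_smul' r t := by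
    change mulAdd X (r • t) = r • mulAdd X t
    induction r using env_induction with
    | h0 => simp only [zero_smul, map_zero]
    | h a c =>
      have h : (mulAdd X).comp (DistribSMul.toAddMonoidHom _ (env a c)) =
          (DistribSMul.toAddMonoidHom _ (env a c)).comp (mulAdd X) :=
        TensorA.hom_ext fun m n => by
          simp [env_smul_tmulA, env_smul, mulAdd_tmulA, coe_lact, coe_ract, mul_assoc]
      exact DFunLike.congr_fun h t
    | hadd r r' h h' => rw [add_smul, map_add, h, h', add_smul]

@[simp] lemma mulMap_tmulA (b : gr X 1) (c : degen X) :
    mulMap X (tmulA b c) = (b * c : B X) := rfl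

/-! ### The quotient by the left augmentation -/

section bar

variable (M N : Type*) [AddCommGroup M] [AddCommGroup N] [Module (Env X) M] [Module (Env X) N]

variable (X) in
/-- The span of the elements `x m - m`. -/
def barSub : Submodule (Env X) M :=
  Submodule.span (Env X) {t | ∃ (x : X) (m : M), t = lact (gA x) m - m}

variable (X) in
/-- `M̄ = ℤ ⊗_A M = M / ⟨x m - m⟩`. -/
abbrev Bar : Type _ := M ⧸ barSub X M

variable {M N}

lemma barSub_le (f : M →ₗ[Env X] N) : barSub X M ≤ (barSub X N).comap f := by
  refine Submodule.span_le.2 ?_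
  rintro _ ⟨x, m, rfl⟩
  refine Submodule.subset_span ⟨x, f m, ?_⟩
  simp [lact]

/-- The map `M̄ → N̄` induced by a morphism of bimodules. -/
def barMap (f : M →ₗ[Env X] N) : Bar X M →ₗ[Env X] Bar X N :=
  Submodule.mapQ _ _ f (barSub_le f)

end bar

variable (X) in
/-- The complex `B̄`, a quotient of `B`. -/
abbrev BBar : Type _ := Bar X (B X)

variable (X) in
/-- The projection `B → B̄`. -/
abbrev pr : B X →ₗ[Env X] BBar X := (barSub X (B X)).mkQ

variable (X) in
/-- The differential of `B̄`. -/
abbrev dBar : BBar X →ₗ[Env X] BBar X := barMap (d X)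

variable (X) in
/-- The degeneracy of `B̄`. -/
abbrev sBar : BBar X →ₗ[Env X] BBar X := barMap (s X)

variable (X) in
/-- `B̄_n`. -/
def grBar (n : ℕ) : Submodule (Env X) (BBar X) := (gr X n).map (pr X)

variable (X) in
/-- `B̄^D_n`. -/
def DBar (n : ℕ) : Submodule (Env X) (BBar X) := (DGr X n).map (pr X)

variable (X) in
/-- `B̄^N_n`. -/
def NBar (n : ℕ) : Submodule (Env X) (BBar X) := (NGr X n).map (pr X)

variable (X) in
/-- `B̄^L_n`, as a submodule of `B̄`. -/
def LBar (n : ℕ) : Submodule (Env X) (BBar X) := ((LGr X n).map (mulMap X)).map (pr X)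

variable (X) in
/-- `B̄^Q_n = B̄_n / B̄^D_n`. -/
abbrev QBar (n : ℕ) : Type _ := grBar X n ⧸ (DBar X n).submoduleOf (grBar X n)

lemma dBar_grBar (n : ℕ) : ∀ b ∈ grBar X (n + 1), dBar X b ∈ grBar X n := by
  rintro _ ⟨b, hb, rfl⟩
  exact ⟨d X b, d_mem_gr hb, rfl⟩

variable (X) in
/-- The differential `B̄_{n+1} → B̄_n`. -/
def dGrBar (n : ℕ) : grBar X (n + 1) →ₗ[Env X] grBar X n :=
  (dBar X).restrict (dBar_grBar n)

/-! ### The rack complex -/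

variable (X) in
/-- `C_n(X)`, the free abelian group on `X^n`. -/
abbrev RC (n : ℕ) : Type _ := (Fin n → X) →₀ ℤ

/-- The tuple with `x_i` omitted. -/
def face0 {n : ℕ} (x : Fin (n + 1) → X) (i : Fin (n + 1)) : Fin n → X :=
  fun j => x (i.succAbove j)

/-- The tuple with `x_i` omitted and the entries before it acted on by `x_i`. -/
def face1 {n : ℕ} (x : Fin (n + 1) → X) (i : Fin (n + 1)) : Fin n → X :=
  fun j => if j.castSucc < i then rop (x (i.succAbove j)) (x i) else x (i.succAbove j)

variable (X) in
/-- The rack differential. -/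
def bdry (n : ℕ) : RC X (n + 1) →ₗ[ℤ] RC X n :=
  Finsupp.linearCombination ℤ fun x => ∑ i : Fin (n + 1), (-1 : ℤ) ^ (i : ℕ) •
    (Finsupp.single (face0 x i) (1 : ℤ) - Finsupp.single (face1 x i) 1)

variable (X) in
/-- `C^D_n`, spanned by the tuples with equal neighbours. -/
def CD (n : ℕ) : Submodule ℤ (RC X n) :=
  Submodule.span ℤ {c | ∃ x : Fin n → X,
    (∃ i j : Fin n, (i : ℕ) + 1 = j ∧ x i = x j) ∧ c = Finsupp.single x 1}

variable (X) in
/-- `C^L_n`, spanned by the tuples with equal neighbours elsewhere than at the beginning. -/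
def CL (n : ℕ) : Submodule ℤ (RC X n) :=
  Submodule.span ℤ {c | ∃ x : Fin n → X,
    (∃ i j : Fin n, 0 < (i : ℕ) ∧ (i : ℕ) + 1 = j ∧ x i = x j) ∧ c = Finsupp.single x 1}

variable (X) in
/-- `C^Q_n = C_n / C^D_n`. -/
abbrev CQ (n : ℕ) : Type _ := RC X n ⧸ CD X n

/-- The monomial `e_{x_1} ⋯ e_{x_n}`. -/
def eMono {n : ℕ} (x : Fin n → X) : B X := (List.ofFn fun i => ge (x i)).prod

end Basic

/-! ### The differential preserves the degenerate part -/

section Spindle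

variable {X : Type*} [Spindle X]

lemma d_ge_sq (x : X) (b : B X) : d X (ge x * (ge x * b)) = ge x * (ge x * d X b) := by
  have h : gx x * ge x = ge x * gx x := by
    have := ge_rel x x
    rwa [show rop x x = x from Spindle.act_self x] at this
  rw [d_ge_mul, d_ge_mul]
  simp only [sub_mul, mul_sub, one_mul, ← mul_assoc, h]
  abel

lemma ge_sq_mem (u v : B X) (x : X) : u * (ge x * ge x) * v ∈ degen X :=
  AddSubgroup.subset_closure ⟨u, x, v, rfl⟩

lemma ge_mul_mem_degen (x : X) {b : B X} (hb : b ∈ degen X) : ge x * b ∈ degen X := by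
  refine closure_stable (AddMonoidHom.mulLeft (ge x)) ?_ b hb
  rintro _ ⟨u, y, v, rfl⟩
  exact AddSubgroup.subset_closure ⟨ge x * u, y, v, by simp [mul_assoc]⟩

/-- The differential preserves `B^D`. -/
lemma d_mem_degen {b : B X} (hb : b ∈ degen X) : d X b ∈ degen X := by
  refine closure_stable (d X).toAddMonoidHom ?_ b hb
  rintro _ ⟨u, y, v, rfl⟩
  change d X _ ∈ degen X
  have key : ∀ u ∈ AddSubgroup.closure (Set.range (word (X := X))),
      d X (u * (ge y * ge y) * v) ∈ degen X := by
    intro u hu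
    induction hu using AddSubgroup.closure_induction with
    | mem u hu =>
      obtain ⟨w, rfl⟩ := hu
      induction w with
      | nil =>
        have := ge_sq_mem 1 (d X v) y
        rwa [one_mul, mul_assoc, ← d_ge_sq, ← mul_assoc, ← one_mul (ge y * ge y)] at this
      | cons c w ih =>
        have hm := ge_sq_mem (word w) v y
        cases c with
        | inl x =>
          rw [word_inl, mul_assoc, mul_assoc, d_gx_mul, ← mul_assoc (word w)]
          exact gx_mul_mem _ _ ih
        | inr x =>
          rw [word_inr, mul_assoc, mul_assoc, d_ge_mul, ← mul_assoc (word w), sub_mul, one_mul]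
          exact sub_mem (sub_mem hm (gx_mul_mem _ _ hm)) (ge_mul_mem_degen _ ih)
    | zero => simp
    | add a b _ _ ha hb => rw [add_mul, add_mul, map_add]; exact add_mem ha hb
    | neg a _ ha => rw [neg_mul, neg_mul, map_neg]; exact neg_mem ha
  exact key u (word_span u)

lemma dBar_DBar (n : ℕ) : ∀ b ∈ DBar X (n + 1), dBar X b ∈ DBar X n := by
  rintro _ ⟨b, hb, rfl⟩
  exact ⟨d X b, ⟨d_mem_degen hb.1, d_mem_gr hb.2⟩, rfl⟩

variable (X) in
/-- The differential `B̄^D_{n+1} → B̄^D_n`. -/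
def dDBar (n : ℕ) : DBar X (n + 1) →ₗ[Env X] DBar X n :=
  (dBar X).restrict (dBar_DBar n)

variable (X) in
/-- The differential `B̄^Q_{n+1} → B̄^Q_n`. -/
def dQBar (n : ℕ) : QBar X (n + 1) →ₗ[Env X] QBar X n :=
  Submodule.mapQ _ _ (dGrBar X n) (fun b hb => dBar_DBar n (b : BBar X) hb)

end Spindle

end ShelfBialg

end

open ShelfBialg

/-! The relation y e_{x^y} = e_x y moves every generator of A = ℤM(X) to the left of every e-letter,
so B is spanned by the monomials m e_{x₁} ⋯ e_{xₙ} with m in M(X). They are independent, because B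
acts on the free abelian group on pairs (m, w) and the monomial with index (m, w) sends (1, []) to
(m, w) (`nf_bas`). Thus B is a free left A-module on words in X, and a left A-linear map out of B is
an arbitrary function on words (`extend`).

Each of the sub-bimodules B_n, B⁺, B^D and B⁺B^D is then the A-span of a set of words: length n,
nonempty, with a repeat (two equal neighbours), with a repeat not at the very beginning. Questions
of injectivity and directness are settled by left A-linear retractions given on words. - Sending x w
to e_x ⊗ e_w inverts multiplication on B^L (`extend_lateWord_mulMap`). - Deleting the first letter
inverts s (`extend_tail_s`). - Sending w to `diffWord w` projects B onto B^N with kernel B^D: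
`diffWord` vanishes on words with a repeat, and e_w - `diffWord w` is degenerate. - Sending x x w to
`diffWord (x w)` and every other word to 0 kills B^L and inverts s on (B^N)⁺ (`ret`).

For the sum, a degenerate word either has a late repeat or has the form x x w = s(x w). Splitting x
w into its B^D and B^N components finishes the second case, since s of a degenerate word is late
(`LGr_sup_NGr`). As B^N represents B^Q, the bimodule isomorphism follows
(`exists_equiv_of_complement`).

The retractions need not respect the right action. They still descend to B̄, because ⟨x m - m⟩ is
already generated additively by the elements x m - m (`mem_closure_of_mem_barSub`); hence the same
decomposition holds there.

In B̄ the term (1 - x) b of d(e_x b) vanishes, so B̄^L is a subcomplex. Idempotence makes x commute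
with e_x, so d passes through e_x e_x without a sign (`d_ge_sq`), whereas it passes a difference e_x
- e_y with a sign. This gives ds = -sd on B̄^N (`pr_d_s`), the sign of the shifted complex.

Finally B̄ has the words in X as a basis, and moving x_i to the front of e_{x₁} ⋯ e_{xₙ} acts on the
entries before it, which is exactly the second face of the rack differential (`d_eMono`). Everything
is then transported to the rack complex. -/

namespace ShelfBialg

section NormalForm

variable {X : Type*} [Shelf X]

/-! ### The normal form of the elements of `B(X)` -/

/-- The right action of the structure monoid on `X`. -/
def actHom : StrMonoid X →* (Function.End X)ᵐᵒᵖ :=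
  PresentedMonoid.lift
    (fun y => (MulOpposite.op (fun x : X => rop x y) : (Function.End X)ᵐᵒᵖ)) (by
    rintro a b ⟨x, y⟩
    simp only [map_mul, FreeMonoid.lift_eval_of]
    -- The relation y x^y = x y acts on z as (z^y)^{x^y} = (z^x)^y, which is self-distributivity.
    refine congrArg MulOpposite.op (funext fun z => ?_)
    exact (rop_rop z x y).symm)

/-- `act x m` is the image of `x` under the right action of `m`. -/
def act (x : X) (m : StrMonoid X) : X := (actHom m).unop x

@[simp] lemma act_one (x : X) : act x (1 : StrMonoid X) = x := by
  rw [act, map_one]; rfl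

lemma act_mul (x : X) (m n : StrMonoid X) : act x (m * n) = act (act x m) n := by
  simp only [act, map_mul, MulOpposite.unop_mul]
  rfl

@[simp] lemma act_of (x y : X) : act x (PresentedMonoid.of (MRel X) y) = rop x y := rfl

/-- The image in `A(X)` of an element of the structure monoid. -/
noncomputable def ofA (m : StrMonoid X) : StrAlg X := MonoidAlgebra.of ℤ (StrMonoid X) m

lemma ofA_one : ofA (1 : StrMonoid X) = 1 := rfl

lemma ofA_mul (m n : StrMonoid X) : ofA (m * n) = ofA m * ofA n :=
  map_mul (MonoidAlgebra.of ℤ (StrMonoid X)) m n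

lemma ofA_of (x : X) : ofA (PresentedMonoid.of (MRel X) x) = gA x := rfl

/-- The image in `B(X)` of an element of the structure monoid. -/
noncomputable def inclM (m : StrMonoid X) : B X := incl (ofA m)

@[simp] lemma inclM_one : inclM (1 : StrMonoid X) = 1 := by rw [inclM, ofA_one, map_one]

lemma inclM_mul (m n : StrMonoid X) : inclM (m * n) = inclM m * inclM n := by
  rw [inclM, ofA_mul, map_mul]; rfl

@[simp] lemma inclM_of (x : X) : inclM (PresentedMonoid.of (MRel X) x) = gx x := by
  rw [inclM, ofA_of, incl_gA]

lemma strMonoid_induction {p : StrMonoid X → Prop} (m : StrMonoid X) (h1 : p 1)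
    (hx : ∀ x m, p m → p (PresentedMonoid.of (MRel X) x * m)) : p m := by
  induction m using PresentedMonoid.inductionOn with
  | h w =>
    induction w using FreeMonoid.inductionOn' with
    | one => exact h1
    | of_mul x w ih => rw [map_mul]; exact hx x _ ih

lemma mem_closure_ofA (a : StrAlg X) : a ∈ AddSubgroup.closure (Set.range (ofA (X := X))) := by
  induction a using strAlg_induction with
  | h1 => exact AddSubgroup.subset_closure ⟨1, ofA_one⟩
  | hx x a ih =>
    refine AddSubgroup.closure_induction (p := fun a _ => gA x * a ∈
      AddSubgroup.closure (Set.range (ofA (X := X)))) ?_ ?_ ?_ ?_ ih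
    · rintro _ ⟨m, rfl⟩
      exact AddSubgroup.subset_closure ⟨PresentedMonoid.of (MRel X) x * m, by
        rw [ofA_mul, ofA_of]⟩
    · rw [mul_zero]; exact zero_mem _
    · intro a b _ _ ha hb; rw [mul_add]; exact add_mem ha hb
    · intro a _ ha; rw [mul_neg]; exact neg_mem ha
  | hadd a b ha hb => exact add_mem ha hb
  | hneg a ha => exact neg_mem ha

/-- The monomial `e_{x₁} ⋯ e_{xₙ}`. -/
noncomputable def eList (w : List X) : B X := (w.map ge).prod

@[simp] lemma eList_nil : eList ([] : List X) = 1 := rfl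

@[simp] lemma eList_cons (x : X) (w : List X) : eList (x :: w) = ge x * eList w := by
  simp [eList]

lemma eList_append (v w : List X) : eList (v ++ w) = eList v * eList w := by simp [eList]

/-- The relation `ge_rel` carries one generator past e_x; iterating it carries all of m to the left,
at the price of acting on the index. -/
lemma ge_mul_inclM (x : X) (m : StrMonoid X) : ge x * inclM m = inclM m * ge (act x m) := by
  induction m using strMonoid_induction generalizing x with
  | h1 => simp
  | hx y m ih =>
    rw [inclM_mul, inclM_of, ← mul_assoc, ← ge_rel, mul_assoc, ih, act_mul, act_of, mul_assoc]

lemma eList_mul_inclM (w : List X) (m : StrMonoid X) :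
    eList w * inclM m = inclM m * eList (w.map fun x => act x m) := by
  induction w with
  | nil => simp
  | cons x w ih =>
    rw [List.map_cons, eList_cons, eList_cons, mul_assoc, ih, ← mul_assoc, ge_mul_inclM, mul_assoc]

/-- The monomials in normal form. -/
noncomputable def bas (m : StrMonoid X) (w : List X) : B X := inclM m * eList w

lemma bas_one (w : List X) : bas 1 w = eList w := by simp [bas]

lemma bas_nil (m : StrMonoid X) : bas m [] = inclM m := by simp [bas]

lemma inclM_mul_bas (m n : StrMonoid X) (w : List X) : inclM m * bas n w = bas (m * n) w := by
  rw [bas, bas, inclM_mul, mul_assoc]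

lemma gx_mul_bas (x : X) (m : StrMonoid X) (w : List X) :
    gx x * bas m w = bas (PresentedMonoid.of (MRel X) x * m) w := by
  rw [← inclM_mul_bas, inclM_of]

lemma ge_mul_bas (x : X) (m : StrMonoid X) (w : List X) :
    ge x * bas m w = bas m (act x m :: w) := by
  rw [bas, ← mul_assoc, ge_mul_inclM, bas, eList_cons, mul_assoc]

lemma bas_mul_bas (m n : StrMonoid X) (v w : List X) :
    bas m v * bas n w = bas (m * n) (v.map (fun x => act x n) ++ w) := by
  rw [bas, bas, bas, inclM_mul, eList_append, mul_assoc, ← mul_assoc (eList v), eList_mul_inclM]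
  simp only [mul_assoc]

/-- The spanning half of the normal form. Straightening only relabels the e-letters, so their number
is the degree. -/
lemma word_eq_bas (w : List (X ⊕ X)) :
    ∃ (m : StrMonoid X) (l : List X), l.length = deg w ∧ word w = bas m l := by
  induction w with
  | nil => exact ⟨1, [], rfl, by simp [bas]⟩
  | cons c w ih =>
    obtain ⟨m, l, hl, h⟩ := ih
    cases c with
    | inl x => exact ⟨PresentedMonoid.of (MRel X) x * m, l, by simpa using hl, by
        rw [word_inl, h, gx_mul_bas]⟩
    | inr x => exact ⟨m, act x m :: l, by simpa using hl, by rw [word_inr, h, ge_mul_bas]⟩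

lemma bas_induction {p : B X → Prop} (b : B X) (h : ∀ m w, p (bas m w)) (h0 : p 0)
    (hadd : ∀ a b, p a → p b → p (a + b)) (hneg : ∀ a, p a → p (-a)) : p b := by
  refine AddSubgroup.closure_induction (p := fun b _ => p b) ?_ h0
    (fun a b _ _ => hadd a b) (fun a _ => hneg a) (word_span b)
  rintro _ ⟨w, rfl⟩
  obtain ⟨m, l, -, h'⟩ := word_eq_bas w
  rw [h']
  exact h m l

variable (X) in
/-- The free abelian group on the normal forms. -/
abbrev NF : Type _ := (StrMonoid X × List X) →₀ ℤ

lemma end_mul_apply {V : Type*} [AddCommGroup V] (f g : AddMonoid.End V) (v : V) :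
    (f * g) v = f (g v) := rfl

/-- The action of the generator `x` on normal forms. -/
noncomputable def nfGx (x : X) : AddMonoid.End (NF X) :=
  (Finsupp.mapDomain.addMonoidHom fun p => (PresentedMonoid.of (MRel X) x * p.1, p.2) :
    NF X →+ NF X)

/-- The action of the generator `e_x` on normal forms. -/
noncomputable def nfGe (x : X) : AddMonoid.End (NF X) :=
  (Finsupp.mapDomain.addMonoidHom fun p => (p.1, act x p.1 :: p.2) : NF X →+ NF X)

lemma nfGx_single (x : X) (p : StrMonoid X × List X) (r : ℤ) :
    nfGx x (Finsupp.single p r) =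
      Finsupp.single (PresentedMonoid.of (MRel X) x * p.1, p.2) r :=
  Finsupp.mapDomain_single

lemma nfGe_single (x : X) (p : StrMonoid X × List X) (r : ℤ) :
    nfGe x (Finsupp.single p r) = Finsupp.single (p.1, act x p.1 :: p.2) r :=
  Finsupp.mapDomain_single

lemma nfGx_rel (x y : X) : nfGx y * nfGx (rop x y) = nfGx x * nfGx y := by
  refine Finsupp.addHom_ext fun p r => ?_
  have h : PresentedMonoid.of (MRel X) y * PresentedMonoid.of (MRel X) (rop x y) =
      PresentedMonoid.of (MRel X) x * PresentedMonoid.of (MRel X) y :=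
    PresentedMonoid.mk_eq_mk_of_rel (MRel.rel x y)
  change nfGx y (nfGx (rop x y) _) = nfGx x (nfGx y _)
  rw [nfGx_single, nfGx_single, nfGx_single, nfGx_single]
  simp only [← mul_assoc, h]

/-- Both sides prepend the same letter, since acting on x by y m is acting on x^y by m. -/
lemma nfGe_rel (x y : X) : nfGx y * nfGe (rop x y) = nfGe x * nfGx y := by
  refine Finsupp.addHom_ext fun p r => ?_
  change nfGx y (nfGe (rop x y) _) = nfGe x (nfGx y _)
  rw [nfGx_single, nfGe_single, nfGx_single, nfGe_single]
  simp only [act_mul, act_of]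

/-- The action of `B(X)` on normal forms. -/
noncomputable def nfAct : B X →+* AddMonoid.End (NF X) := lift nfGx nfGe nfGx_rel nfGe_rel

lemma nfAct_gx (x : X) (m : StrMonoid X) (w : List X) (r : ℤ) :
    nfAct (gx x) (Finsupp.single (m, w) r) =
      Finsupp.single (PresentedMonoid.of (MRel X) x * m, w) r := by
  rw [nfAct, lift_gx, nfGx_single]

lemma nfAct_ge (x : X) (m : StrMonoid X) (w : List X) (r : ℤ) :
    nfAct (ge x) (Finsupp.single (m, w) r) = Finsupp.single (m, act x m :: w) r := by
  rw [nfAct, lift_ge, nfGe_single]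

variable (X) in
/-- The normal form of an element of `B(X)`. -/
noncomputable def nf : B X →+ NF X :=
  (AddMonoidHom.eval (Finsupp.single ((1 : StrMonoid X), ([] : List X)) (1 : ℤ))).comp
    (nfAct (X := X)).toAddMonoidHom

/-- The independence half: a monomial applied to (1, []) reproduces its own index, so B is free as a
left A-module on words. -/
lemma nf_bas (m : StrMonoid X) (w : List X) : nf X (bas m w) = Finsupp.single (m, w) 1 := by
  change nfAct (bas m w) (Finsupp.single ((1 : StrMonoid X), ([] : List X)) (1 : ℤ)) = _
  rw [bas, map_mul, end_mul_apply]
  -- The e-letters act before m does, while the monoid entry is still 1, so they enter the word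
  -- unchanged.
  have h : nfAct (eList w) (Finsupp.single ((1 : StrMonoid X), ([] : List X)) (1 : ℤ)) =
      Finsupp.single ((1 : StrMonoid X), w) (1 : ℤ) := by
    induction w with
    | nil => simp
    | cons x w ih => rw [eList_cons, map_mul, end_mul_apply, ih, nfAct_ge, act_one]
  rw [h]
  induction m using strMonoid_induction with
  | h1 => simp
  | hx x m ih => rw [inclM_mul, map_mul, end_mul_apply, ih, inclM_of, nfAct_gx]

/-! ### Left `A(X)`-linear maps out of `B(X)` -/

lemma addHom_ext_bas {P : Type*} [AddCommGroup P] {f g : B X →+ P}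
    (h : ∀ m w, f (bas m w) = g (bas m w)) : f = g := by
  ext b
  induction b using bas_induction with
  | h m w => exact h m w
  | h0 => simp
  | hadd a b ha hb => rw [map_add, map_add, ha, hb]
  | hneg a ha => rw [map_neg, map_neg, ha]

section extend

variable {P : Type*} [AddCommGroup P] [Module (Env X) P]

/-- The left `A(X)`-linear map sending the monomial `e_{x₁} ⋯ e_{xₙ}` to `φ [x₁, …, xₙ]`. -/
noncomputable def extend (φ : List X → P) : B X →+ P :=
  (Finsupp.liftAddHom fun p : StrMonoid X × List X =>
    (zmultiplesHom P (lact (ofA p.1) (φ p.2)) : ℤ →+ P)).comp (nf X)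

@[simp] lemma extend_bas (φ : List X → P) (m : StrMonoid X) (w : List X) :
    extend φ (bas m w) = lact (ofA m) (φ w) := by
  simp [extend, nf_bas]

lemma extend_eList (φ : List X → P) (w : List X) : extend φ (eList w) = φ w := by
  rw [← bas_one, extend_bas, ofA_one, lact_one]

lemma lact_neg (a : StrAlg X) (m : P) : lact a (-m) = -lact a m := smul_neg ..

lemma lact_zero (a : StrAlg X) : lact a (0 : P) = 0 := smul_zero _

/-- Only left linearity can be expected: φ is arbitrary, so `extend φ` need not respect the right
action. -/
lemma extend_inclM_mul (φ : List X → P) (m : StrMonoid X) (b : B X) :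
    extend φ (inclM m * b) = lact (ofA m) (extend φ b) := by
  induction b using bas_induction with
  | h n w => rw [inclM_mul_bas, extend_bas, extend_bas, ofA_mul, lact_mul]
  | h0 => simp [lact_zero]
  | hadd a b ha hb => rw [mul_add, map_add, map_add, ha, hb, lact_add]
  | hneg a ha => rw [mul_neg, map_neg, map_neg, ha, lact_neg]

lemma extend_gx_mul (φ : List X → P) (x : X) (b : B X) :
    extend φ (gx x * b) = lact (gA x) (extend φ b) := by
  rw [← inclM_of, extend_inclM_mul, ofA_of]

end extend

lemma lact_ofA_B (m : StrMonoid X) (b : B X) : lact (ofA m) b = inclM m * b := lact_B _ _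

@[simp] lemma extend_B_bas (φ : List X → B X) (m : StrMonoid X) (w : List X) :
    extend φ (bas m w) = inclM m * φ w := by rw [extend_bas, lact_ofA_B]

/-! ### Spans of monomials -/

/-- The left `A(X)`-span of the monomials `e_{x₁} ⋯ e_{xₙ}` satisfying a given property. -/
def W (P : List X → Prop) : AddSubgroup (B X) :=
  AddSubgroup.closure {b | ∃ m w, P w ∧ b = bas m w}

lemma bas_mem_W {P : List X → Prop} (m : StrMonoid X) {w : List X} (h : P w) : bas m w ∈ W P :=
  AddSubgroup.subset_closure ⟨m, w, h, rfl⟩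

lemma W_le {P : List X → Prop} {S : AddSubgroup (B X)} (h : ∀ m w, P w → bas m w ∈ S) :
    W P ≤ S := by
  refine (AddSubgroup.closure_le _).2 ?_
  rintro _ ⟨m, w, hw, rfl⟩
  exact h m w hw

lemma W_eqOn {Q : Type*} [AddCommGroup Q] {P : List X → Prop} {f g : B X →+ Q}
    (h : ∀ m w, P w → f (bas m w) = g (bas m w)) {b : B X} (hb : b ∈ W P) : f b = g b :=
  W_le (S := f.eqLocus g) (fun m w hw => h m w hw) hb

lemma W_map_mem {P : List X → Prop} {S : AddSubgroup (B X)} (f : B X →+ B X)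
    (h : ∀ m w, P w → f (bas m w) ∈ S) {b : B X} (hb : b ∈ W P) : f b ∈ S :=
  W_le (S := S.comap f) (fun m w hw => h m w hw) hb

open Classical in
/-- The projection of `B(X)` onto the span of the monomials with a given property. -/
noncomputable def proj (P : List X → Prop) : B X →+ B X :=
  extend fun w => if P w then eList w else 0

lemma proj_bas_of_pos {P : List X → Prop} (m : StrMonoid X) {w : List X} (h : P w) :
    proj P (bas m w) = bas m w := by
  rw [proj, extend_B_bas, if_pos h, bas]

lemma proj_bas_of_neg {P : List X → Prop} (m : StrMonoid X) {w : List X} (h : ¬ P w) :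
    proj P (bas m w) = 0 := by
  rw [proj, extend_B_bas, if_neg h, mul_zero]

lemma proj_of_mem {P : List X → Prop} {b : B X} (hb : b ∈ W P) : proj P b = b :=
  W_eqOn (f := proj P) (g := AddMonoidHom.id _) (fun m _ hw => proj_bas_of_pos m hw) hb

/-- Discarding the monomials outside Q fixes W Q pointwise and maps W P into the span of the words
with both properties. This rests on the independence of the monomials. -/
lemma W_inf (P Q : List X → Prop) : W P ⊓ W Q = W fun w => P w ∧ Q w := by
  apply le_antisymm
  · rintro b ⟨hP, hQ⟩
    rw [← proj_of_mem hQ]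
    refine W_map_mem (proj Q) (fun m w hw => ?_) hP
    by_cases h : Q w
    · rw [proj_bas_of_pos m h]; exact bas_mem_W m ⟨hw, h⟩
    · rw [proj_bas_of_neg m h]; exact zero_mem _
  · exact le_inf (W_le fun m w hw => bas_mem_W m hw.1) (W_le fun m w hw => bas_mem_W m hw.2)

lemma eList_mem_gr (w : List X) : eList w ∈ gr X w.length := by
  induction w with
  | nil => exact word_mem_gr ([] : List (X ⊕ X))
  | cons x w ih => rw [eList_cons]; exact ge_mul_mem_gr x ih

lemma incl_mul_mem (P : Submodule (Env X) (B X)) (a : StrAlg X) {b : B X} (hb : b ∈ P) :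
    incl a * b ∈ P := by
  have := P.smul_mem (env a 1) hb
  rwa [env_smul, map_one, mul_one] at this

lemma inclM_mul_mem (P : Submodule (Env X) (B X)) (m : StrMonoid X) {b : B X} (hb : b ∈ P) :
    inclM m * b ∈ P := incl_mul_mem P _ hb

lemma gr_eq_W (n : ℕ) : (gr X n).toAddSubgroup = W fun w => w.length = n := by
  apply le_antisymm
  · refine (AddSubgroup.closure_le _).2 ?_
    rintro _ ⟨w, rfl, rfl⟩
    obtain ⟨m, l, hl, h⟩ := word_eq_bas w
    rw [h]
    exact bas_mem_W m hl
  · refine W_le ?_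
    rintro m w rfl
    exact inclM_mul_mem _ m (eList_mem_gr w)

lemma mem_gr_iff {n : ℕ} {b : B X} : b ∈ gr X n ↔ b ∈ W fun w => w.length = n := by
  rw [← gr_eq_W]; rfl

lemma bas_mem_gr (m : StrMonoid X) (w : List X) : bas m w ∈ gr X w.length :=
  mem_gr_iff.2 (bas_mem_W m rfl)

lemma pos_eq_W : (pos X).toAddSubgroup = W fun w => w ≠ [] := by
  apply le_antisymm
  · intro b hb
    refine Submodule.iSup_induction _ (motive := fun b => b ∈ W fun w : List X => w ≠ []) hb ?_
      (zero_mem _) (fun a b => add_mem)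
    intro n b hb
    refine W_le (fun m w hw => bas_mem_W m ?_) (mem_gr_iff.1 hb)
    rintro rfl
    simp at hw
  · refine W_le fun m w hw => ?_
    obtain ⟨x, w, rfl⟩ := List.exists_cons_of_ne_nil hw
    exact Submodule.mem_iSup_of_mem w.length (bas_mem_gr m (x :: w))

lemma mem_pos_iff {b : B X} : b ∈ pos X ↔ b ∈ W fun w => w ≠ [] := by
  rw [← pos_eq_W]; rfl

lemma gr_le_pos (n : ℕ) : gr X (n + 1) ≤ pos X := le_iSup (fun n => gr X (n + 1)) n

end NormalForm

/-! ### Degenerate words -/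

section Words

variable {X : Type*}

/-- A word with two equal neighbours. -/
def IsDeg (w : List X) : Prop := ¬ w.IsChain (· ≠ ·)

/-- A word with two equal neighbours elsewhere than at the beginning. -/
def IsLate (w : List X) : Prop := IsDeg w.tail

@[simp] lemma not_isDeg_nil : ¬ IsDeg ([] : List X) := by simp [IsDeg]

@[simp] lemma not_isDeg_singleton (x : X) : ¬ IsDeg [x] := by simp [IsDeg]

@[simp] lemma isDeg_cons_cons {x y : X} {w : List X} :
    IsDeg (x :: y :: w) ↔ x = y ∨ IsDeg (y :: w) := by
  simp only [IsDeg, List.isChain_cons_cons, not_and_or, not_not]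

lemma IsDeg.cons {w : List X} (h : IsDeg w) (x : X) : IsDeg (x :: w) := by
  cases w with
  | nil => simp at h
  | cons y w => exact isDeg_cons_cons.2 (Or.inr h)

lemma IsDeg.append_left {w : List X} (h : IsDeg w) : ∀ v : List X, IsDeg (v ++ w)
  | [] => h
  | x :: v => (IsDeg.append_left h v).cons x

/-- This lets repeats survive the relabelling of letters when products are straightened. -/
lemma IsDeg.map {Y : Type*} {w : List X} (h : IsDeg w) (f : X → Y) : IsDeg (w.map f) := by
  intro h'
  rw [List.isChain_map] at h'
  exact h (h'.imp fun a b hab e => hab (congrArg f e))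

lemma IsDeg.append_right {w : List X} (h : IsDeg w) (v : List X) : IsDeg (w ++ v) :=
  fun h' => h h'.left_of_append

lemma IsDeg.two_le {w : List X} (h : IsDeg w) : 2 ≤ w.length := by
  match w, h with
  | [], h => simp at h
  | [x], h => simp at h
  | x :: y :: w, _ => simp

@[simp] lemma isLate_cons {x : X} {w : List X} : IsLate (x :: w) ↔ IsDeg w := Iff.rfl

lemma IsLate.isDeg {w : List X} (h : IsLate w) : IsDeg w := by
  cases w with
  | nil => exact h
  | cons x w => exact IsDeg.cons h x

lemma isDeg_ofFn {n : ℕ} (x : Fin n → X) :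
    IsDeg (List.ofFn x) ↔ ∃ i j : Fin n, (i : ℕ) + 1 = j ∧ x i = x j := by
  simp only [IsDeg, List.isChain_iff_getElem, List.getElem_ofFn, List.length_ofFn]
  push Not
  constructor
  · rintro ⟨i, hi, h⟩
    exact ⟨⟨i, by omega⟩, ⟨i + 1, hi⟩, rfl, h⟩
  · rintro ⟨i, ⟨_, hj⟩, rfl, h⟩
    exact ⟨i, hj, h⟩

lemma isLate_ofFn {n : ℕ} (x : Fin n → X) :
    IsLate (List.ofFn x) ↔
      ∃ i j : Fin n, 0 < (i : ℕ) ∧ (i : ℕ) + 1 = j ∧ x i = x j := by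
  cases n with
  | zero => simp [IsLate]
  | succ n =>
    rw [List.ofFn_succ, isLate_cons, isDeg_ofFn]
    constructor
    · rintro ⟨i, j, h, h'⟩
      exact ⟨i.succ, j.succ, by simp, by simpa using h, h'⟩
    · rintro ⟨i, j, h0, h, h'⟩
      obtain ⟨i, rfl⟩ := Fin.exists_succ_eq.2 (Fin.pos_iff_ne_zero.1 h0)
      obtain ⟨j, rfl⟩ := Fin.exists_succ_eq.2
        (Fin.pos_iff_ne_zero.1 (show 0 < j from Fin.lt_def.2 (by rw [← h]; exact Nat.succ_pos _)))
      exact ⟨i, j, by simpa using h, h'⟩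

lemma face0_zero {n : ℕ} (x : Fin (n + 1) → X) : face0 x 0 = fun i => x i.succ := rfl

end Words

/-! ### Induction on spans of monomials and compatibility with products -/

section Decomposition

variable {X : Type*} [Spindle X]

lemma W_induction {P : List X → Prop} {p : (b : B X) → b ∈ W P → Prop}
    (bas : ∀ m w (h : P w), p (bas m w) (bas_mem_W m h))
    (zero : p 0 (zero_mem _))
    (add : ∀ a b ha hb, p a ha → p b hb → p (a + b) (add_mem ha hb))
    (neg : ∀ a ha, p a ha → p (-a) (neg_mem ha)) {b : B X} (hb : b ∈ W P) : p b hb := by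
  refine AddSubgroup.closure_induction (p := p) ?_ zero add neg hb
  rintro _ ⟨m, w, hw, rfl⟩
  exact bas m w hw

lemma W_mono {P Q : List X → Prop} (h : ∀ w, P w → Q w) : W P ≤ W Q :=
  W_le fun m w hw => bas_mem_W m (h w hw)

lemma mem_W_and {P Q : List X → Prop} {b : B X} :
    b ∈ W (fun w => P w ∧ Q w) ↔ b ∈ W P ∧ b ∈ W Q := by
  rw [← W_inf]; rfl

lemma map_incl_mul (f : B X →ₗ[Env X] B X) (a : StrAlg X) (b : B X) :
    f (incl a * b) = incl a * f b := by
  have h := f.map_smul (env a 1) b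
  simpa only [env_smul, map_one, mul_one] using h

lemma map_inclM_mul (f : B X →ₗ[Env X] B X) (m : StrMonoid X) (b : B X) :
    f (inclM m * b) = inclM m * f b := map_incl_mul f _ b

lemma mul_mem_gr {m n : ℕ} {b c : B X} (hb : b ∈ gr X m) (hc : c ∈ gr X n) :
    b * c ∈ gr X (m + n) := by
  refine W_map_mem (S := (gr X (m + n)).toAddSubgroup) (AddMonoidHom.mulRight c)
    (fun m' v hv => ?_) (mem_gr_iff.1 hb)
  refine W_map_mem (S := (gr X (m + n)).toAddSubgroup) (AddMonoidHom.mulLeft (bas m' v))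
    (fun n' w hw => ?_) (mem_gr_iff.1 hc)
  change bas m' v * bas n' w ∈ gr X (m + n)
  rw [bas_mul_bas, mem_gr_iff]
  exact bas_mem_W _ (by simp [hv, hw])

/-! ### The degenerate part -/

lemma eList_mem_degen {w : List X} (h : IsDeg w) : eList w ∈ degen X := by
  induction w with
  | nil => simp at h
  | cons x w ih =>
    cases w with
    | nil => simp at h
    | cons y w =>
      rcases isDeg_cons_cons.1 h with rfl | h
      · have := ge_sq_mem 1 (eList w) x
        rwa [one_mul, mul_assoc, ← eList_cons, ← eList_cons] at this
      · rw [eList_cons]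
        exact ge_mul_mem_degen x (ih h)

/-- Straightening u e_x e_x v only relabels letters, so the two equal neighbours stay equal. The
ideal is therefore spanned by monomials, although the e_x² generate it under multiplication by all
of B. -/
lemma degen_eq_W : (degen X).toAddSubgroup = W IsDeg := by
  apply le_antisymm
  · refine (AddSubgroup.closure_le _).2 ?_
    rintro _ ⟨u, x, v, rfl⟩
    induction u using bas_induction with
    | h m u =>
      induction v using bas_induction with
      | h n v =>
        have h : bas m u * (ge x * ge x) = bas m (u ++ [x, x]) := by
          simp [bas, eList_append, mul_assoc]
        rw [h, bas_mul_bas]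
        refine bas_mem_W _ (IsDeg.append_right (IsDeg.map (IsDeg.append_left ?_ _) _) _)
        simp
      | h0 => rw [mul_zero]; exact zero_mem _
      | hadd a b ha hb => rw [mul_add]; exact add_mem ha hb
      | hneg a ha => rw [mul_neg]; exact neg_mem ha
    | h0 => rw [zero_mul, zero_mul]; exact zero_mem _
    | hadd a b ha hb => rw [add_mul, add_mul]; exact add_mem ha hb
    | hneg a ha => rw [neg_mul, neg_mul]; exact neg_mem ha
  · exact W_le fun m w hw => inclM_mul_mem _ m (eList_mem_degen hw)

lemma mem_degen_iff {b : B X} : b ∈ degen X ↔ b ∈ W IsDeg := by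
  rw [← degen_eq_W]; rfl

lemma mem_DGr_iff {n : ℕ} {b : B X} :
    b ∈ DGr X n ↔ b ∈ W fun w => IsDeg w ∧ w.length = n := by
  rw [mem_W_and, ← mem_degen_iff, ← mem_gr_iff, Submodule.mem_inf]

lemma ge_mul_mem_DGr (x : X) {n : ℕ} {b : B X} (hb : b ∈ DGr X n) : ge x * b ∈ DGr X (n + 1) :=
  ⟨ge_mul_mem_degen x hb.1, ge_mul_mem_gr x hb.2⟩

lemma DGr_eq_bot {n : ℕ} (hn : n < 2) : DGr X n = ⊥ := by
  rw [eq_bot_iff]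
  intro b hb
  refine W_le (S := ⊥) (fun m w hw => ?_) (mem_DGr_iff.1 hb)
  have := hw.1.two_le
  omega

/-! ### The degeneracy -/

lemma s_bas_nil (m : StrMonoid X) : s X (bas m []) = 0 := by
  rw [bas, map_inclM_mul, eList_nil, s_one, mul_zero]

lemma s_bas_cons (m : StrMonoid X) (x : X) (w : List X) :
    s X (bas m (x :: w)) = bas m (x :: x :: w) := by
  rw [bas, map_inclM_mul, eList_cons, s_ge_mul, bas, eList_cons, eList_cons, mul_assoc (ge x)]

lemma s_mem_DGr {n : ℕ} {b : B X} (hb : b ∈ gr X (n + 1)) : s X b ∈ DGr X (n + 2) := by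
  refine W_map_mem (S := (DGr X (n + 2)).toAddSubgroup) (s X).toAddMonoidHom (fun m w hw => ?_)
    (mem_gr_iff.1 hb)
  cases w with
  | nil => simp at hw
  | cons x w =>
    change s X _ ∈ DGr X (n + 2)
    rw [s_bas_cons, mem_DGr_iff]
    exact bas_mem_W m ⟨by simp, by simpa using hw⟩

lemma s_mem_degen (b : B X) : s X b ∈ degen X := by
  induction b using bas_induction with
  | h m w =>
    cases w with
    | nil => rw [s_bas_nil]; exact zero_mem _
    | cons x w => rw [s_bas_cons, mem_degen_iff]; exact bas_mem_W m (by simp)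
  | h0 => rw [map_zero]; exact zero_mem _
  | hadd a b ha hb => rw [map_add]; exact add_mem ha hb
  | hneg a ha => rw [map_neg]; exact neg_mem ha

/-- In normal form s doubles the first letter, so deleting the first letter undoes it. Degree 0 is
excluded because s is extended there by 0. -/
lemma extend_tail_s {b : B X} (hb : b ∈ pos X) : extend (fun w => eList w.tail) (s X b) = b := by
  refine W_eqOn (f := (extend fun w : List X => eList w.tail).comp (s X).toAddMonoidHom)
    (g := AddMonoidHom.id _) (fun m w hw => ?_) (mem_pos_iff.1 hb)
  obtain ⟨x, w, rfl⟩ := List.exists_cons_of_ne_nil hw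
  change extend (fun w : List X => eList w.tail) (s X (bas m (x :: w))) = bas m (x :: w)
  rw [s_bas_cons, extend_B_bas, List.tail_cons, bas]

lemma s_injOn : Set.InjOn (s X) (pos X : Set (B X)) := by
  intro a ha b hb h
  rw [← extend_tail_s ha, h, extend_tail_s hb]

/-! ### The late degenerate part -/

lemma TensorA.induction {M N : Type*} [AddCommGroup M] [AddCommGroup N] [Module (Env X) M]
    [Module (Env X) N] {p : TensorA X M N → Prop} (t : TensorA X M N) (zero : p 0)
    (tmul : ∀ m n, p (tmulA m n)) (add : ∀ t u, p t → p u → p (t + u)) : p t := by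
  obtain ⟨t, rfl⟩ := QuotientAddGroup.mk'_surjective (balanced X M N) t
  induction t using TensorProduct.induction_on with
  | zero => rw [map_zero]; exact zero
  | tmul m n => exact tmul m n
  | add t u ht hu => rw [map_add]; exact add _ _ ht hu

/-- The left factor puts at least one letter in front, so the repeat coming from the right factor
cannot begin the word. -/
lemma mul_mem_W_isLate {b c : B X} (hb : b ∈ pos X) (hc : c ∈ degen X) : b * c ∈ W IsLate := by
  refine W_map_mem (AddMonoidHom.mulRight c) (fun m v hv => ?_) (mem_pos_iff.1 hb)
  refine W_map_mem (AddMonoidHom.mulLeft (bas m v)) (fun n w hw => ?_) (mem_degen_iff.1 hc)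
  change bas m v * bas n w ∈ _
  obtain ⟨x, v, rfl⟩ := List.exists_cons_of_ne_nil hv
  rw [bas_mul_bas]
  exact bas_mem_W _ (hw.append_left _)

lemma ge_mem_gr (x : X) : ge x ∈ gr X 1 := by simpa using eList_mem_gr [x]

lemma bas_cons_eq_mulMap (m : StrMonoid X) (x : X) {w : List X} (hw : IsDeg w) :
    bas m (x :: w) = mulMap X (tmulA ⟨inclM m * ge x, inclM_mul_mem _ m (ge_mem_gr x)⟩
      ⟨eList w, eList_mem_degen hw⟩) := by
  rw [mulMap_tmulA, bas, eList_cons, mul_assoc]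

lemma mem_range_mulMap_iff {b : B X} : b ∈ LinearMap.range (mulMap X) ↔ b ∈ W IsLate := by
  constructor
  · rintro ⟨t, rfl⟩
    induction t using TensorA.induction with
    | zero => rw [map_zero]; exact zero_mem _
    | tmul b c => exact mul_mem_W_isLate (gr_le_pos 0 b.2) c.2
    | add t u ht hu => rw [map_add]; exact add_mem ht hu
  · intro hb
    refine W_le (S := (LinearMap.range (mulMap X)).toAddSubgroup) (fun m w hw => ?_) hb
    cases w with
    | nil => exact (not_isDeg_nil hw).elim
    | cons x w => exact ⟨_, (bas_cons_eq_mulMap m x hw).symm⟩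

/-- Left factors of degree 1 suffice: every late word is one letter followed by a degenerate word.
-/
lemma range_mulMap_eq_span : LinearMap.range (mulMap X) =
    Submodule.span (Env X) {t | ∃ b ∈ pos X, ∃ c ∈ degen X, t = b * c} := by
  apply le_antisymm
  · rintro _ ⟨t, rfl⟩
    induction t using TensorA.induction with
    | zero => rw [map_zero]; exact zero_mem _
    | tmul b c => exact Submodule.subset_span ⟨b, gr_le_pos 0 b.2, c, c.2, rfl⟩
    | add t u ht hu => rw [map_add]; exact add_mem ht hu
  · refine Submodule.span_le.2 ?_
    rintro _ ⟨b, hb, c, hc, rfl⟩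
    exact mem_range_mulMap_iff.2 (mul_mem_W_isLate hb hc)

lemma range_mulMap_le : LinearMap.range (mulMap X) ≤ degen X := fun _ hb =>
  mem_degen_iff.2 (W_mono (fun _ => IsLate.isDeg) (mem_range_mulMap_iff.1 hb))

lemma LGr_map_eq (n : ℕ) :
    (LGr X n).map (mulMap X) = LinearMap.range (mulMap X) ⊓ gr X n := by
  apply le_antisymm
  · rw [Submodule.map_le_iff_le_comap]
    refine Submodule.span_le.2 ?_
    rintro _ ⟨b, c, m, rfl, hc, rfl⟩
    refine ⟨⟨_, rfl⟩, ?_⟩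
    rw [add_comm]
    exact mul_mem_gr b.2 hc
  · rintro b ⟨hb, hb'⟩
    have h := mem_W_and.2 ⟨mem_range_mulMap_iff.1 hb, mem_gr_iff.1 hb'⟩
    refine W_le (S := ((LGr X n).map (mulMap X)).toAddSubgroup) ?_ h
    rintro m w ⟨hw, hl⟩
    cases w with
    | nil => exact (not_isDeg_nil hw).elim
    | cons x w =>
      rw [bas_cons_eq_mulMap m x (isLate_cons.1 hw)]
      exact ⟨_, Submodule.subset_span ⟨_, _, w.length, hl, eList_mem_gr w, rfl⟩, rfl⟩

lemma mem_LGr_map_iff {n : ℕ} {b : B X} :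
    b ∈ (LGr X n).map (mulMap X) ↔ b ∈ W fun w => IsLate w ∧ w.length = n := by
  rw [LGr_map_eq, Submodule.mem_inf, mem_W_and, mem_range_mulMap_iff, mem_gr_iff]

lemma LGr_map_le (n : ℕ) : (LGr X n).map (mulMap X) ≤ DGr X n := by
  rw [LGr_map_eq]
  exact inf_le_inf_right _ range_mulMap_le

open Classical in
/-- The image of a word in `B^L`: the class of `e_x ⊗ e_w` for the word `x w` if `w` is
degenerate, and `0` otherwise. -/
noncomputable def lateWord : List X → BL X
  | [] => 0
  | x :: w => if h : IsDeg w then tmulA ⟨ge x, ge_mem_gr x⟩ ⟨eList w, eList_mem_degen h⟩ else 0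

lemma lateWord_cons (x : X) {w : List X} (h : IsDeg w) :
    lateWord (x :: w) = tmulA ⟨ge x, ge_mem_gr x⟩ ⟨eList w, eList_mem_degen h⟩ := dif_pos h

lemma lact_tmulA {M N : Type*} [AddCommGroup M] [AddCommGroup N] [Module (Env X) M]
    [Module (Env X) N] (a : StrAlg X) (m : M) (n : N) :
    lact a (tmulA (X := X) m n) = tmulA (lact a m) n := by
  rw [lact, env_smul_tmulA, ract_one]

lemma tmulA_zero_left {M N : Type*} [AddCommGroup M] [AddCommGroup N] [Module (Env X) M]
    [Module (Env X) N] (n : N) : tmulA (X := X) (0 : M) n = 0 := by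
  simpa using tmulA_add_left (X := X) (0 : M) 0 n

lemma tmulA_zero_right {M N : Type*} [AddCommGroup M] [AddCommGroup N] [Module (Env X) M]
    [Module (Env X) N] (m : M) : tmulA (X := X) m (0 : N) = 0 := by
  simpa using tmulA_add_right (X := X) m (0 : N) 0

lemma tmulA_neg_left {M N : Type*} [AddCommGroup M] [AddCommGroup N] [Module (Env X) M]
    [Module (Env X) N] (m : M) (n : N) : tmulA (X := X) (-m) n = -tmulA m n := by
  rw [eq_neg_iff_add_eq_zero, ← tmulA_add_left, neg_add_cancel, tmulA_zero_left]

lemma tmulA_neg_right {M N : Type*} [AddCommGroup M] [AddCommGroup N] [Module (Env X) M]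
    [Module (Env X) N] (m : M) (n : N) : tmulA (X := X) m (-n) = -tmulA m n := by
  rw [eq_neg_iff_add_eq_zero, ← tmulA_add_right, neg_add_cancel, tmulA_zero_right]

/-- `extend lateWord` inverts multiplication. By biadditivity it is enough to compare the two sides
on monomials. -/
lemma extend_lateWord_mul {b c : B X} (hb : b ∈ gr X 1) (hc : c ∈ degen X) :
    extend lateWord (b * c) = tmulA (X := X) (⟨b, hb⟩ : gr X 1) (⟨c, hc⟩ : degen X) := by
  refine W_induction (p := fun b hb => extend lateWord (b * c) =
    tmulA (X := X) (⟨b, mem_gr_iff.2 hb⟩ : gr X 1) (⟨c, hc⟩ : degen X)) ?_ ?_ ?_ ?_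
    (mem_gr_iff.1 hb)
  · intro m v hv
    obtain ⟨x, rfl⟩ := List.length_eq_one_iff.1 hv
    refine W_induction (p := fun c hc => extend lateWord (bas m [x] * c) =
      tmulA (X := X) (⟨bas m [x], mem_gr_iff.2 (bas_mem_W m rfl)⟩ : gr X 1)
        (⟨c, mem_degen_iff.2 hc⟩ : degen X)) ?_ ?_ ?_ ?_ (mem_degen_iff.1 hc)
    · intro n w hw
      have h1 : (⟨bas n w, mem_degen_iff.2 (bas_mem_W n hw)⟩ : degen X) =
          lact (ofA n) ⟨eList w, eList_mem_degen hw⟩ := by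
        refine Subtype.ext ?_
        rw [coe_lact]
        rfl
      -- The coefficient n of the right factor crosses the tensor sign; straightening e_x n in the
      -- left factor then gives the same relabelled letter as straightening the product.
      rw [h1, ← tmulA_ract, bas_mul_bas, extend_bas, List.map_cons, List.map_nil,
        List.singleton_append, lateWord_cons _ hw, lact_tmulA]
      congr 1
      refine Subtype.ext ?_
      rw [coe_lact, coe_ract]
      change inclM _ * ge _ = bas m [x] * inclM n
      rw [← bas_nil n, bas_mul_bas]
      simp [bas]
    · rw [mul_zero, map_zero]; exact (tmulA_zero_right _).symm
    · intro a b ha hb iha ihb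
      rw [mul_add, map_add, iha, ihb]; exact (tmulA_add_right ..).symm
    · intro a ha iha
      rw [mul_neg, map_neg, iha]; exact (tmulA_neg_right ..).symm
  · rw [zero_mul, map_zero]; exact (tmulA_zero_left _).symm
  · intro a b ha hb iha ihb
    rw [add_mul, map_add, iha, ihb]; exact (tmulA_add_left ..).symm
  · intro a ha iha
    rw [neg_mul, map_neg, iha]; exact (tmulA_neg_left ..).symm

lemma extend_lateWord_mulMap (t : BL X) : extend lateWord (mulMap X t) = t :=
  DFunLike.congr_fun (TensorA.hom_ext (f := (extend lateWord).comp (mulMap X).toAddMonoidHom)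
    (g := AddMonoidHom.id _) fun b c => extend_lateWord_mul b.2 c.2) t

lemma mulMap_injective : Function.Injective (mulMap X) :=
  Function.LeftInverse.injective extend_lateWord_mulMap

/-! ### The complement -/

lemma diffWord_mem_BN (l : List X) : diffWord l ∈ BN X :=
  AddSubgroup.subset_closure ⟨1, l, by simp⟩

lemma BN_le {S : AddSubgroup (B X)} (h : ∀ m l, inclM m * diffWord l ∈ S) {b : B X}
    (hb : b ∈ BN X) : b ∈ S := by
  refine (AddSubgroup.closure_le S).2 ?_ hb
  rintro _ ⟨a, l, rfl⟩
  refine AddSubgroup.closure_induction (p := fun a _ => incl a * diffWord l ∈ S) ?_ ?_ ?_ ?_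
    (mem_closure_ofA a)
  · rintro _ ⟨m, rfl⟩; exact h m l
  · rw [map_zero, zero_mul]; exact zero_mem _
  · intro a b _ _ ha hb; rw [map_add, add_mul]; exact add_mem ha hb
  · intro a _ ha; rw [map_neg, neg_mul]; exact neg_mem ha

lemma diffWord_mem_gr (l : List X) : diffWord l ∈ gr X l.length := by
  induction l with
  | nil => exact eList_mem_gr []
  | cons x l ih =>
    cases l with
    | nil => exact ge_mem_gr x
    | cons y l =>
      rw [diffWord, sub_mul]
      exact sub_mem (ge_mul_mem_gr x ih) (ge_mul_mem_gr y ih)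

lemma diffWord_eq_zero {l : List X} (h : IsDeg l) : diffWord l = 0 := by
  induction l with
  | nil => simp at h
  | cons x l ih =>
    cases l with
    | nil => simp at h
    | cons y l =>
      rcases isDeg_cons_cons.1 h with rfl | h
      · rw [diffWord, sub_self, zero_mul]
      · rw [diffWord, ih h, mul_zero]

/-- Replacing e_x by e_x - e_y in front of a word starting with y changes it by a word starting with
y y, so each word agrees with its `diffWord` modulo B^D. -/
lemma eList_sub_diffWord_mem (l : List X) : eList l - diffWord l ∈ DGr X l.length := by
  induction l with
  | nil => simp [diffWord]
  | cons x l ih =>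
    cases l with
    | nil => simp [diffWord]
    | cons y l =>
      have h : eList (x :: y :: l) - diffWord (x :: y :: l) =
          ge x * (eList (y :: l) - diffWord (y :: l)) -
            ge y * (eList (y :: l) - diffWord (y :: l)) + eList (y :: y :: l) := by
        simp only [eList_cons, diffWord]
        noncomm_ring
      rw [h]
      refine add_mem (sub_mem (ge_mul_mem_DGr x ih) (ge_mul_mem_DGr y ih)) ?_
      exact ⟨eList_mem_degen (by simp), eList_mem_gr (y :: y :: l)⟩

variable (X) in
/-- The projection onto `B^N` with kernel `B^D`. -/
noncomputable abbrev projN : B X →+ B X := extend diffWord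

lemma projN_mem (b : B X) : projN X b ∈ BN X := by
  induction b using bas_induction with
  | h m w => rw [extend_B_bas]; exact inclM_mul_mem _ m (diffWord_mem_BN w)
  | h0 => rw [map_zero]; exact zero_mem _
  | hadd a b ha hb => rw [map_add]; exact add_mem ha hb
  | hneg a ha => rw [map_neg]; exact neg_mem ha

lemma projN_degen {b : B X} (hb : b ∈ degen X) : projN X b = 0 :=
  W_eqOn (f := projN X) (g := 0)
    (fun m w hw => by rw [extend_B_bas, diffWord_eq_zero hw, mul_zero]; rfl)
    (mem_degen_iff.1 hb)

/-- The projection kills e_l - `diffWord l` and sends e_l to `diffWord l`, hence it fixes `diffWord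
l`. -/
lemma projN_of_mem {b : B X} (hb : b ∈ BN X) : projN X b = b := by
  refine BN_le (S := (projN X).eqLocus (AddMonoidHom.id _)) (fun m l => ?_) hb
  change projN X _ = inclM m * diffWord l
  have h := projN_degen (eList_sub_diffWord_mem l).1
  rw [map_sub, extend_eList, sub_eq_zero] at h
  rw [extend_inclM_mul, ← h, lact_ofA_B]

lemma projN_mem_gr {n : ℕ} {b : B X} (hb : b ∈ gr X n) : projN X b ∈ NGr X n := by
  refine ⟨projN_mem b, ?_⟩
  refine W_map_mem (S := (gr X n).toAddSubgroup) (projN X) (fun m w hw => ?_) (mem_gr_iff.1 hb)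
  subst hw
  rw [extend_B_bas]
  exact inclM_mul_mem _ m (diffWord_mem_gr w)

lemma sub_projN_mem {n : ℕ} {b : B X} (hb : b ∈ gr X n) : b - projN X b ∈ DGr X n := by
  refine W_map_mem (S := (DGr X n).toAddSubgroup) (AddMonoidHom.id _ - projN X)
    (fun m w hw => ?_) (mem_gr_iff.1 hb)
  subst hw
  change bas m w - projN X (bas m w) ∈ DGr X w.length
  rw [extend_B_bas, bas, ← mul_sub]
  exact inclM_mul_mem _ m (eList_sub_diffWord_mem w)

/-- Homogeneous generators for B^N_n, which is only defined as an intersection: an element is its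
own projection, and the projection sends words of length n to `diffWord`s of length n. -/
lemma NGr_le {n : ℕ} {S : AddSubgroup (B X)}
    (h : ∀ m (l : List X), l.length = n → inclM m * diffWord l ∈ S) {b : B X}
    (hb : b ∈ NGr X n) : b ∈ S := by
  rw [← projN_of_mem hb.1]
  exact W_map_mem (projN X) (fun m w hw => by rw [extend_B_bas]; exact h m w hw)
    (mem_gr_iff.1 hb.2)

lemma DGr_inf_NGr (n : ℕ) : DGr X n ⊓ NGr X n = ⊥ := by
  rw [eq_bot_iff]
  rintro b ⟨h, h'⟩
  rw [Submodule.mem_bot, ← projN_of_mem h'.1, projN_degen h.1]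

lemma DGr_sup_NGr (n : ℕ) : DGr X n ⊔ NGr X n = gr X n := by
  refine le_antisymm (sup_le inf_le_right inf_le_right) fun b hb => ?_
  rw [← sub_add_cancel b (projN X b)]
  exact Submodule.add_mem_sup (sub_projN_mem hb) (projN_mem_gr hb)

/-! ### The decomposition of the degenerate part -/

open Classical in
/-- The value at a word of a left inverse of the degeneracy that vanishes on `B^L`. -/
noncomputable def retWord : List X → B X
  | x :: y :: w => if x = y then diffWord (y :: w) else 0
  | _ => 0

/-- A word x x w may also have a late repeat; its value is still 0, because `diffWord (x w)` then
vanishes by itself. -/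
lemma retWord_eq_zero {w : List X} (h : IsLate w) : retWord w = 0 := by
  match w, h with
  | [], _ => rfl
  | [_], _ => rfl
  | x :: y :: w, h => rw [retWord, diffWord_eq_zero (isLate_cons.1 h), ite_self]

lemma retWord_cons_self (x : X) (w : List X) : retWord (x :: x :: w) = diffWord (x :: w) := by
  rw [retWord, if_pos rfl]

variable (X) in
/-- A left inverse of the degeneracy on `(B^N)⁺` that vanishes on `B^L`. -/
noncomputable abbrev ret : B X →+ B X := extend retWord

lemma ret_of_mem_range {b : B X} (hb : b ∈ LinearMap.range (mulMap X)) : ret X b = 0 :=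
  W_eqOn (f := ret X) (g := 0)
    (fun m w hw => by rw [extend_B_bas, retWord_eq_zero hw, mul_zero]; rfl)
    (mem_range_mulMap_iff.1 hb)

lemma ret_s {b : B X} (hb : b ∈ pos X) : ret X (s X b) = projN X b := by
  refine W_eqOn (f := (ret X).comp (s X).toAddMonoidHom) (g := projN X) (fun m w hw => ?_)
    (mem_pos_iff.1 hb)
  obtain ⟨x, w, rfl⟩ := List.exists_cons_of_ne_nil hw
  change ret X (s X _) = _
  rw [s_bas_cons, extend_B_bas, extend_B_bas, retWord_cons_self]

lemma ret_s_of_mem {b : B X} (hb : b ∈ pos X) (hb' : b ∈ BN X) : ret X (s X b) = b := by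
  rw [ret_s hb, projN_of_mem hb']

/-- The map `ret` vanishes on the first summand and recovers b from s(b) on the second. -/
lemma disjoint_mulMap_s :
    Disjoint (LinearMap.range (mulMap X)) ((BN X ⊓ pos X).map (s X)) := by
  rw [Submodule.disjoint_def]
  rintro _ h ⟨b, ⟨hN, hp⟩, rfl⟩
  rw [← ret_s_of_mem hp hN, ret_of_mem_range h, map_zero]

lemma NGr_le_inf (n : ℕ) : NGr X (n + 1) ≤ BN X ⊓ pos X := inf_le_inf_left _ (gr_le_pos n)

lemma LGr_map_le_range (n : ℕ) : (LGr X n).map (mulMap X) ≤ LinearMap.range (mulMap X) :=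
  LinearMap.map_le_range

lemma disjoint_LGr_NGr (n : ℕ) :
    Disjoint ((LGr X (n + 2)).map (mulMap X)) ((NGr X (n + 1)).map (s X)) :=
  disjoint_mulMap_s.mono (LGr_map_le_range _) (Submodule.map_mono (NGr_le_inf n))

/-- Doubling the first letter pushes an existing repeat one place to the right, where it is late. -/
lemma s_mem_LGr_map {n : ℕ} {b : B X} (hb : b ∈ DGr X (n + 1)) :
    s X b ∈ (LGr X (n + 2)).map (mulMap X) := by
  refine W_map_mem (S := ((LGr X (n + 2)).map (mulMap X)).toAddSubgroup) (s X).toAddMonoidHom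
    (fun m w hw => ?_) (mem_DGr_iff.1 hb)
  change s X _ ∈ (LGr X (n + 2)).map (mulMap X)
  obtain ⟨hw, hl⟩ := hw
  cases w with
  | nil => simp at hw
  | cons x w =>
    rw [s_bas_cons, mem_LGr_map_iff]
    exact bas_mem_W m ⟨hw, by simpa using hl⟩

lemma LGr_sup_NGr (n : ℕ) :
    (LGr X (n + 2)).map (mulMap X) ⊔ (NGr X (n + 1)).map (s X) = DGr X (n + 2) := by
  apply le_antisymm
  · refine sup_le (LGr_map_le _) ?_
    rintro _ ⟨b, hb, rfl⟩
    exact s_mem_DGr hb.2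
  · intro b hb
    refine W_le (S := ((LGr X (n + 2)).map (mulMap X) ⊔
      (NGr X (n + 1)).map (s X)).toAddSubgroup) ?_ (mem_DGr_iff.1 hb)
    rintro m w ⟨hw, hl⟩
    match w, hw, hl with
    | x :: y :: w, hw, hl =>
      rcases isDeg_cons_cons.1 hw with rfl | hw
      · have hg : bas m (x :: w) ∈ gr X (n + 1) := mem_gr_iff.2 (bas_mem_W m (by simpa using hl))
        -- The word x x w is s(x w). The B^D component of x w contributes a late term, its B^N
        -- component lies in the second summand.
        rw [← s_bas_cons, ← sub_add_cancel (bas m (x :: w)) (projN X (bas m (x :: w))), map_add]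
        exact Submodule.add_mem_sup (s_mem_LGr_map (sub_projN_mem hg)) ⟨_, projN_mem_gr hg, rfl⟩
      · exact Submodule.mem_sup_left (mem_LGr_map_iff.2 (bas_mem_W m ⟨hw, hl⟩))

lemma range_mulMap_sup :
    LinearMap.range (mulMap X) ⊔ (BN X ⊓ pos X).map (s X) = degen X := by
  apply le_antisymm
  · refine sup_le range_mulMap_le ?_
    rintro _ ⟨b, -, rfl⟩
    exact s_mem_degen b
  · intro b hb
    refine W_le (S := (LinearMap.range (mulMap X) ⊔ (BN X ⊓ pos X).map (s X)).toAddSubgroup)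
      (fun m w hw => ?_) (mem_degen_iff.1 hb)
    obtain ⟨n, hn⟩ := Nat.exists_eq_add_of_le' hw.two_le
    have h : bas m w ∈ DGr X (n + 2) := mem_DGr_iff.2 (bas_mem_W m ⟨hw, hn⟩)
    rw [← LGr_sup_NGr] at h
    exact sup_le_sup (LGr_map_le_range _) (Submodule.map_mono (NGr_le_inf n)) h

end Decomposition

/-! ### Decompositions from complements -/

section Complement

variable {R V L : Type*} [Ring R] [AddCommGroup V] [Module R V] [AddCommGroup L] [Module R L]

lemma isCompl_submoduleOf {G D N : Submodule R V} (hinf : D ⊓ N = ⊥) (hsup : D ⊔ N = G) :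
    IsCompl (D.submoduleOf G) (N.submoduleOf G) := by
  constructor
  · rw [Submodule.disjoint_def]
    intro x h h'
    exact Subtype.ext ((Submodule.mem_bot R).1 (hinf ▸ (⟨h, h'⟩ : (x : V) ∈ D ⊓ N)))
  · rw [codisjoint_iff, eq_top_iff]
    rintro ⟨x, hx⟩ -
    obtain ⟨a, ha, b, hb, rfl⟩ := Submodule.mem_sup.1 (hsup ▸ hx)
    have ha' : a ∈ G := hsup ▸ Submodule.mem_sup_left ha
    have hb' : b ∈ G := hsup ▸ Submodule.mem_sup_right hb
    exact Submodule.add_mem_sup (S := D.submoduleOf G) (T := N.submoduleOf G)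
      (s := ⟨a, ha'⟩) (t := ⟨b, hb'⟩) ha hb

/-- If `G = D ⊕ N` and `E = j(L) ⊕ s(N)`, with `j` injective and `s` injective on `N`, then
`L ⊕ G / D ≃ E`. -/
lemma exists_equiv_of_complement {G D N E : Submodule R V} (hinf : D ⊓ N = ⊥) (hsup : D ⊔ N = G)
    (j : L →ₗ[R] V) (hj : Function.Injective j) (s : V →ₗ[R] V) (hs : ∀ b ∈ N, s b = 0 → b = 0)
    (hdis : Disjoint (LinearMap.range j) (N.map s)) (hE : LinearMap.range j ⊔ N.map s = E) :
    ∃ Φ : (L × (G ⧸ D.submoduleOf G)) ≃ₗ[R] E, ∀ (l : L) (b : G), (b : V) ∈ N →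
      ((Φ (l, Submodule.Quotient.mk b) : E) : V) = j l + s (b : V) := by
  have hc := isCompl_submoduleOf hinf hsup
  let e := Submodule.quotientEquivOfIsCompl _ _ hc
  let f : L × (G ⧸ D.submoduleOf G) →ₗ[R] V :=
    j.coprod (s ∘ₗ G.subtype ∘ₗ (N.submoduleOf G).subtype ∘ₗ e.toLinearMap)
  have he : ∀ (b : G) (hb : (b : V) ∈ N), e (Submodule.Quotient.mk b) = ⟨b, hb⟩ := fun b hb =>
    Submodule.quotientEquivOfIsCompl_apply_mk_right hc (⟨b, hb⟩ : N.submoduleOf G)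
  have hf : ∀ (l : L) (b : G), (b : V) ∈ N → f (l, Submodule.Quotient.mk b) = j l + s (b : V) := by
    intro l b hb
    change j l + s (((e (Submodule.Quotient.mk b) : N.submoduleOf G) : G) : V) = _
    rw [he b hb]
  -- Each class has a representative in N, where the formula for f is known, so all further checks
  -- are made on such representatives.
  have hrep : ∀ q : G ⧸ D.submoduleOf G, ∃ b : G, (b : V) ∈ N ∧ Submodule.Quotient.mk b = q :=
    fun q => ⟨(e q : G), (e q).2, e.injective (he _ (e q).2)⟩
  have hfE : ∀ p, f p ∈ E := by
    rintro ⟨l, q⟩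
    obtain ⟨b, hb, rfl⟩ := hrep q
    rw [hf l b hb, ← hE]
    exact Submodule.add_mem_sup ⟨l, rfl⟩ ⟨b, hb, rfl⟩
  refine ⟨LinearEquiv.ofBijective (f.codRestrict E hfE) ⟨?_, ?_⟩, fun l b hb => hf l b hb⟩
  · rw [injective_iff_map_eq_zero]
    rintro ⟨l, q⟩ h
    obtain ⟨b, hb, rfl⟩ := hrep q
    have h1 : j l + s (b : V) = 0 := by
      rw [← hf l b hb]; exact congrArg Subtype.val h
    have h2 : s (b : V) = 0 := by
      refine Submodule.disjoint_def.1 hdis _ ?_ ⟨b, hb, rfl⟩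
      exact ⟨-l, by rw [map_neg, neg_eq_iff_add_eq_zero, h1]⟩
    have h3 : b = 0 := Subtype.ext (hs _ hb h2)
    rw [h2, add_zero] at h1
    have h4 : l = 0 := hj (by rw [h1, map_zero])
    rw [h3, h4]
    rfl
  · rintro ⟨x, hx⟩
    rw [← hE] at hx
    obtain ⟨_, ⟨l, rfl⟩, _, ⟨b, hb, rfl⟩, rfl⟩ := Submodule.mem_sup.1 hx
    have hb' : b ∈ G := hsup ▸ Submodule.mem_sup_right hb
    exact ⟨(l, Submodule.Quotient.mk ⟨b, hb'⟩), Subtype.ext (hf l ⟨b, hb'⟩ hb)⟩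

end Complement

/-! ### The bimodule isomorphism `B^L_n ⊕ B^Q_{n-1} ≃ B^D_n` -/

section Phi

variable {X : Type*} [Spindle X]

lemma exists_equiv_DGr (n : ℕ) :
    ∃ Φ : (LGr X (n + 2) × QGr X (n + 1)) ≃ₗ[Env X] DGr X (n + 2),
      ∀ (l : LGr X (n + 2)) (b : gr X (n + 1)), (b : B X) ∈ BN X →
        ((Φ (l, Submodule.Quotient.mk b) : DGr X (n + 2)) : B X) =
          mulMap X (l : BL X) + s X (b : B X) := by
  have hr : LinearMap.range ((mulMap X).domRestrict (LGr X (n + 2))) =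
      (LGr X (n + 2)).map (mulMap X) := LinearMap.range_domRestrict _ _
  obtain ⟨Φ, h⟩ := exists_equiv_of_complement (DGr_inf_NGr (X := X) (n + 1))
    (DGr_sup_NGr (n + 1)) ((mulMap X).domRestrict (LGr X (n + 2)))
    (fun a b hab => Subtype.ext (mulMap_injective hab)) (s X)
    (fun b hb h => by rw [← ret_s_of_mem (gr_le_pos n hb.2) hb.1, h, map_zero])
    (hr ▸ disjoint_LGr_NGr n) (hr ▸ LGr_sup_NGr n)
  exact ⟨Φ, fun l b hb => h l b ⟨hb, b.2⟩⟩

end Phi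

section BarComplex

variable {X : Type*} [Spindle X]

/-! ### The functor `M ↦ M̄` -/

/-- The additive span of the x m - m is already a sub-bimodule: the right action commutes with the
left one and preserves the form x m - m, while acting by x on the left changes t by x t - t, itself
a generator. Maps that are only left linear can therefore be tested on these generators. -/
lemma mem_closure_of_mem_barSub {M : Type*} [AddCommGroup M] [Module (Env X) M] {t : M}
    (ht : t ∈ barSub X M) :
    t ∈ AddSubgroup.closure {t : M | ∃ (x : X) (m : M), t = lact (gA x) m - m} := by
  set S := AddSubgroup.closure {t : M | ∃ (x : X) (m : M), t = lact (gA x) m - m} with hS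
  have hR : ∀ (c : StrAlg X), ∀ t ∈ S, ract t c ∈ S := by
    intro c t ht
    have : S ≤ S.comap (DistribSMul.toAddMonoidHom M (env 1 c)) := by
      refine (AddSubgroup.closure_le _).2 ?_
      rintro _ ⟨x, m, rfl⟩
      refine AddSubgroup.subset_closure ⟨x, ract m c, ?_⟩
      rw [lact_ract]
      exact smul_sub _ _ _
    exact this ht
  have hL : ∀ (a : StrAlg X), ∀ t ∈ S, lact a t ∈ S := by
    intro a t ht
    induction a using strAlg_induction with
    | h1 => rwa [lact_one]
    | hx x a ih =>
      rw [lact_mul, ← sub_add_cancel (lact (gA x) (lact a t)) (lact a t)]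
      exact add_mem (AddSubgroup.subset_closure ⟨x, _, rfl⟩) ih
    | hadd a b ha hb => rw [add_lact]; exact add_mem ha hb
    | hneg a ha =>
      have h : lact (-a) t = -lact a t := by
        rw [eq_neg_iff_add_eq_zero, ← add_lact, neg_add_cancel]
        have := add_lact (0 : StrAlg X) 0 t
        simpa using this
      rw [h]; exact neg_mem ha
  refine Submodule.span_induction (p := fun t _ => t ∈ S)
    (fun t ht => AddSubgroup.subset_closure ht) (zero_mem _) (fun a b _ _ ha hb => add_mem ha hb) (fun r t _ ht => ?_) ht
  induction r using env_induction with
  | h0 => rw [zero_smul]; exact zero_mem _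
  | h a c =>
    rw [env_eq, mul_smul]
    exact hL a _ (hR c t ht)
  | hadd r r' h h' => rw [add_smul]; exact add_mem h h'

lemma extend_mem_barSub {M : Type*} [AddCommGroup M] [Module (Env X) M] (φ : List X → M)
    {b : B X} (hb : b ∈ barSub X (B X)) : extend φ b ∈ barSub X M := by
  have h : AddSubgroup.closure {t : B X | ∃ (x : X) (m : B X), t = lact (gA x) m - m} ≤
      (barSub X M).toAddSubgroup.comap (extend φ) := by
    refine (AddSubgroup.closure_le _).2 ?_
    rintro _ ⟨x, b, rfl⟩
    refine Submodule.subset_span ⟨x, extend φ b, ?_⟩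
    rw [map_sub, lact_B, incl_gA, extend_gx_mul]
  exact h (mem_closure_of_mem_barSub hb)

lemma pr_eq_zero_iff {b : B X} : pr X b = 0 ↔ b ∈ barSub X (B X) :=
  Submodule.Quotient.mk_eq_zero _

lemma pr_eq_iff {a b : B X} : pr X a = pr X b ↔ a - b ∈ barSub X (B X) :=
  Submodule.Quotient.eq _

lemma pr_gx_mul (x : X) (b : B X) : pr X (gx x * b) = pr X b :=
  pr_eq_iff.2 (Submodule.subset_span ⟨x, b, by rw [lact_B, incl_gA]⟩)

lemma pr_inclM_mul (m : StrMonoid X) (b : B X) : pr X (inclM m * b) = pr X b := by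
  induction m using strMonoid_induction with
  | h1 => rw [inclM_one, one_mul]
  | hx x m ih => rw [inclM_mul, inclM_of, mul_assoc, pr_gx_mul, ih]

lemma pr_bas (m : StrMonoid X) (w : List X) : pr X (bas m w) = pr X (eList w) :=
  pr_inclM_mul m _

lemma sBar_pr (b : B X) : sBar X (pr X b) = pr X (s X b) := rfl

/-- Passing to the quotient by the augmentation need not preserve injectivity, but it does for a map
with a left A-linear retraction, since the retraction descends too. -/
lemma barMap_injective {M : Type*} [AddCommGroup M] [Module (Env X) M] (f : M →ₗ[Env X] B X)
    (φ : List X → M) (h : ∀ m, extend φ (f m) = m) : Function.Injective (barMap f) := by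
  rw [injective_iff_map_eq_zero]
  intro t ht
  obtain ⟨t, rfl⟩ := Submodule.mkQ_surjective _ t
  have ht' : f t ∈ barSub X (B X) := (Submodule.Quotient.mk_eq_zero _).1 ht
  refine (Submodule.Quotient.mk_eq_zero _).2 ?_
  have := extend_mem_barSub φ ht'
  rwa [h] at this

lemma barMap_mulMap_injective : Function.Injective (barMap (mulMap X)) :=
  barMap_injective _ lateWord extend_lateWord_mulMap

open Classical in
/-- The class of a degenerate word in `B^D`, and `0` for the other words. -/
noncomputable def degWord (w : List X) : degen X :=
  if h : IsDeg w then ⟨eList w, eList_mem_degen h⟩ else 0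

lemma extend_degWord {b : B X} (hb : b ∈ degen X) : extend degWord b = ⟨b, hb⟩ := by
  refine Subtype.ext ?_
  refine W_eqOn (f := (degen X).subtype.toAddMonoidHom.comp (extend degWord))
    (g := AddMonoidHom.id _) (fun m w hw => ?_) (mem_degen_iff.1 hb)
  change ((extend degWord (bas m w) : degen X) : B X) = bas m w
  rw [extend_bas, coe_lact, degWord, dif_pos hw]
  rfl

lemma barMap_degen_injective : Function.Injective (barMap (degen X).subtype) :=
  barMap_injective _ degWord fun b => extend_degWord b.2

/-! ### Stability under the differential -/

/-- The term (1 - x) e_w of the Leibniz rule vanishes in B̄, and so does the effect of the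
coefficient m. -/
lemma d_bas_cons (m : StrMonoid X) (x : X) (w : List X) :
    pr X (d X (bas m (x :: w))) = -pr X (ge x * d X (eList w)) := by
  rw [bas, map_inclM_mul, pr_inclM_mul, eList_cons, d_ge_mul, map_sub, sub_mul, one_mul, map_sub,
    pr_gx_mul, sub_self, zero_sub]

lemma dBar_LBar (n : ℕ) : ∀ b ∈ LBar X (n + 1), dBar X b ∈ LBar X n := by
  rintro _ ⟨b, hb, rfl⟩
  refine W_le (S := ((LBar X n).comap (dBar X ∘ₗ pr X)).toAddSubgroup) ?_ (mem_LGr_map_iff.1 hb)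
  rintro m w ⟨hw, hl⟩
  cases w with
  | nil => exact (not_isDeg_nil hw).elim
  | cons x w =>
    have hw' : IsDeg w := hw
    change pr X (d X (bas m (x :: w))) ∈ LBar X n
    rw [d_bas_cons]
    refine neg_mem ⟨_, ?_, rfl⟩
    -- A degenerate tail has at least two letters, so its degree is a successor and d lowers it by
    -- one.
    obtain ⟨k, hk⟩ := Nat.exists_eq_add_of_le' hw'.two_le
    have hn : n = k + 2 := by simpa [hk] using hl.symm
    subst hn
    rw [LGr_map_eq]
    refine ⟨mem_range_mulMap_iff.2 (mul_mem_W_isLate (gr_le_pos 0 (ge_mem_gr x))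
      (d_mem_degen (eList_mem_degen hw'))), ge_mul_mem_gr x (d_mem_gr ?_)⟩
    rw [← hk]
    exact eList_mem_gr w

/-- Multiplication by a single e_x need not preserve B^N, but multiplication by a difference does:
with z the first letter of the next word, e_a - e_c = (e_a - e_z) - (e_c - e_z). -/
lemma ge_sub_mul_mem_BN (x y : X) {b : B X} (hb : b ∈ BN X) : (ge x - ge y) * b ∈ BN X := by
  refine BN_le (S := (BN X).toAddSubgroup.comap (AddMonoidHom.mulLeft (ge x - ge y)))
    (fun m l => ?_) hb
  change (ge x - ge y) * (inclM m * diffWord l) ∈ BN X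
  rw [← mul_assoc, sub_mul, ge_mul_inclM, ge_mul_inclM, ← mul_sub, mul_assoc]
  refine inclM_mul_mem _ m ?_
  generalize act x m = a
  generalize act y m = c
  cases l with
  | nil =>
    have := sub_mem (diffWord_mem_BN [a]) (diffWord_mem_BN [c])
    simpa [diffWord] using this
  | cons z l =>
    have := sub_mem (diffWord_mem_BN (a :: z :: l)) (diffWord_mem_BN (c :: z :: l))
    rwa [diffWord, diffWord, ← sub_mul, sub_sub_sub_cancel_right] at this

lemma d_ge_sub_mul (x y : X) (b : B X) :
    d X ((ge x - ge y) * b) = gx y * b - gx x * b - (ge x - ge y) * d X b := by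
  rw [sub_mul, map_sub, d_ge_mul, d_ge_mul]
  noncomm_ring

lemma d_diffWord_mem (l : List X) : d X (diffWord l) ∈ BN X := by
  induction l with
  | nil => rw [diffWord, d_one]; exact zero_mem _
  | cons x l ih =>
    cases l with
    | nil =>
      have h := diffWord_mem_BN ([] : List X)
      rw [diffWord] at h
      rw [diffWord, d_ge]
      refine sub_mem h ?_
      simpa using gx_mul_mem (BN X) x h
    | cons y l =>
      rw [diffWord, d_ge_sub_mul]
      have h := diffWord_mem_BN (y :: l)
      exact sub_mem (sub_mem (gx_mul_mem _ y h) (gx_mul_mem _ x h)) (ge_sub_mul_mem_BN x y ih)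

/-- The differential preserves `B^N`. -/
lemma d_mem_BN {b : B X} (hb : b ∈ BN X) : d X b ∈ BN X := by
  refine BN_le (S := (BN X).toAddSubgroup.comap (d X).toAddMonoidHom) (fun m l => ?_) hb
  change d X (inclM m * diffWord l) ∈ BN X
  rw [map_inclM_mul]
  exact inclM_mul_mem _ m (d_diffWord_mem l)

lemma d_mem_NGr {n : ℕ} {b : B X} (hb : b ∈ NGr X (n + 1)) : d X b ∈ NGr X n :=
  ⟨d_mem_BN hb.1, d_mem_gr hb.2⟩

/-- On `B̄^N` the degeneracy anticommutes with the differential. -/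
lemma pr_d_s {n : ℕ} {b : B X} (hb : b ∈ NGr X (n + 2)) :
    pr X (d X (s X b)) = -pr X (s X (d X b)) := by
  rw [eq_neg_iff_add_eq_zero]
  refine NGr_le (S := (LinearMap.ker
    (pr X ∘ₗ d X ∘ₗ s X + pr X ∘ₗ s X ∘ₗ d X)).toAddSubgroup) (fun m l hl => ?_) hb
  change pr X (d X (s X (inclM m * diffWord l))) + pr X (s X (d X (inclM m * diffWord l))) = 0
  simp only [map_inclM_mul, pr_inclM_mul]
  -- The degree is at least 2, so the word starts with a genuine difference e_x - e_y.
  match l, hl with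
  | x :: y :: l, _ =>
    have h1 : s X (diffWord (x :: y :: l)) =
        ge x * (ge x * diffWord (y :: l)) - ge y * (ge y * diffWord (y :: l)) := by
      rw [diffWord, sub_mul, map_sub, s_ge_mul, s_ge_mul, mul_assoc, mul_assoc]
    have h2 : s X (d X (diffWord (x :: y :: l))) =
        gx y * s X (diffWord (y :: l)) - gx x * s X (diffWord (y :: l)) -
          (ge x * (ge x * d X (diffWord (y :: l))) -
            ge y * (ge y * d X (diffWord (y :: l)))) := by
      rw [diffWord, d_ge_sub_mul, map_sub, map_sub, s_gx_mul, s_gx_mul, sub_mul, map_sub,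
        s_ge_mul, s_ge_mul, mul_assoc, mul_assoc]
    -- In h2 the terms y s(b') - x s(b') coming from d(e_x - e_y) = y - x cancel in B̄. What remains
    -- is the negative of d(h1), as d passes through e_x e_x and e_y e_y without a sign.
    rw [h1, h2, map_sub (d X), d_ge_sq, d_ge_sq, map_sub (pr X) (_ - _) (_ - _),
      map_sub (pr X) (gx y * _), pr_gx_mul, pr_gx_mul, sub_self, zero_sub, add_neg_cancel]

/-! ### The decomposition in `B̄` -/

lemma pr_ret_eq_zero {b : B X} (h : pr X b = 0) : pr X (ret X b) = 0 :=
  pr_eq_zero_iff.2 (extend_mem_barSub _ (pr_eq_zero_iff.1 h))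

lemma pr_projN_eq_zero {b : B X} (h : pr X b = 0) : pr X (projN X b) = 0 :=
  pr_eq_zero_iff.2 (extend_mem_barSub _ (pr_eq_zero_iff.1 h))

lemma ret_s_of_mem_NGr {n : ℕ} {b : B X} (hb : b ∈ NGr X (n + 1)) : ret X (s X b) = b :=
  ret_s_of_mem (gr_le_pos n hb.2) hb.1

lemma sBar_eq_zero {n : ℕ} {b : BBar X} (hb : b ∈ NBar X (n + 1)) (h : sBar X b = 0) : b = 0 := by
  obtain ⟨b, hb, rfl⟩ := hb
  rw [sBar_pr] at h
  have := pr_ret_eq_zero h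
  rwa [ret_s_of_mem_NGr hb] at this

/-- If s(b) and a late l agree in B̄, then `ret`, which descends to B̄, shows that the class of b is
0. -/
lemma disjoint_LBar_NBar (n : ℕ) :
    Disjoint (LBar X (n + 2)) ((NBar X (n + 1)).map (sBar X)) := by
  rw [Submodule.disjoint_def]
  rintro y ⟨l, hl, rfl⟩ ⟨_, ⟨b, hb, rfl⟩, h⟩
  have h1 : pr X (s X b - l) = 0 := by rw [map_sub, sub_eq_zero]; exact h
  have h2 := pr_ret_eq_zero h1
  rw [map_sub, ret_s_of_mem_NGr hb, ret_of_mem_range (LGr_map_le_range _ hl), sub_zero] at h2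
  rw [← h, h2, map_zero]

lemma NBar_map_sBar (n : ℕ) :
    (NBar X n).map (sBar X) = ((NGr X n).map (s X)).map (pr X) := by
  rw [NBar, ← Submodule.map_comp, ← Submodule.map_comp]
  rfl

lemma LBar_sup_NBar (n : ℕ) :
    LBar X (n + 2) ⊔ (NBar X (n + 1)).map (sBar X) = DBar X (n + 2) := by
  rw [NBar_map_sBar, LBar, ← Submodule.map_sup, LGr_sup_NGr, DBar]

lemma DBar_inf_NBar (n : ℕ) : DBar X n ⊓ NBar X n = ⊥ := by
  rw [eq_bot_iff]
  rintro _ ⟨⟨a, ha, rfl⟩, ⟨b, hb, h⟩⟩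
  have h1 : pr X (b - a) = 0 := by rw [map_sub, sub_eq_zero]; exact h
  have h2 := pr_projN_eq_zero h1
  rw [map_sub, projN_of_mem hb.1, projN_degen ha.1, sub_zero] at h2
  rw [Submodule.mem_bot, ← h, h2]

lemma DBar_sup_NBar (n : ℕ) : DBar X n ⊔ NBar X n = grBar X n := by
  rw [DBar, NBar, ← Submodule.map_sup, DGr_sup_NGr, grBar]

lemma NBar_le_grBar (n : ℕ) : NBar X n ≤ grBar X n := Submodule.map_mono inf_le_right

lemma LBar_le_DBar (n : ℕ) : LBar X n ≤ DBar X n := Submodule.map_mono (LGr_map_le n)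

lemma DBar_one : DBar X 1 = ⊥ := by rw [DBar, DGr_eq_bot (by omega), Submodule.map_bot]

lemma LBar_one : LBar X 1 = ⊥ := by
  rw [eq_bot_iff, ← DBar_one]
  exact LBar_le_DBar 1

lemma dBar_NBar {n : ℕ} {b : BBar X} (hb : b ∈ NBar X (n + 1)) : dBar X b ∈ NBar X n := by
  obtain ⟨b, hb, rfl⟩ := hb
  exact ⟨d X b, d_mem_NGr hb, rfl⟩

lemma dBar_sBar {n : ℕ} {b : BBar X} (hb : b ∈ NBar X (n + 2)) :
    dBar X (sBar X b) = -sBar X (dBar X b) := by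
  obtain ⟨b, hb, rfl⟩ := hb
  exact pr_d_s hb

lemma sBar_NBar_map_dBar (n : ℕ) :
    ((NBar X (n + 2)).map (sBar X)).map (dBar X) ≤ (NBar X (n + 1)).map (sBar X) := by
  rintro _ ⟨_, ⟨b, hb, rfl⟩, rfl⟩
  rw [dBar_sBar hb]
  exact neg_mem ⟨_, dBar_NBar hb, rfl⟩

/-- In degree 1 the differential is d(e_x) = 1 - x, which vanishes in B̄. -/
lemma dBar_grBar_one {b : BBar X} (hb : b ∈ grBar X 1) : dBar X b = 0 := by
  obtain ⟨b, hb, rfl⟩ := hb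
  refine W_le (S := (LinearMap.ker (dBar X ∘ₗ pr X)).toAddSubgroup) (fun m w hw => ?_)
    (mem_gr_iff.1 hb)
  obtain ⟨x, rfl⟩ := List.length_eq_one_iff.1 hw
  change pr X (d X (bas m [x])) = 0
  rw [d_bas_cons, eList_nil, d_one, mul_zero, map_zero, neg_zero]

/-! ### The isomorphism of complexes in `B̄` -/

lemma exists_equiv_DBar (n : ℕ) :
    ∃ Φ : (LBar X (n + 2) × QBar X (n + 1)) ≃ₗ[Env X] DBar X (n + 2),
      ∀ (l : LBar X (n + 2)) (b : grBar X (n + 1)), (b : BBar X) ∈ NBar X (n + 1) →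
        ((Φ (l, Submodule.Quotient.mk b) : DBar X (n + 2)) : BBar X) =
          (l : BBar X) + sBar X (b : BBar X) := by
  have hr : LinearMap.range (LBar X (n + 2)).subtype = LBar X (n + 2) := Submodule.range_subtype _
  exact exists_equiv_of_complement (DBar_inf_NBar (X := X) (n + 1)) (DBar_sup_NBar (n + 1))
    (LBar X (n + 2)).subtype (Submodule.subtype_injective _) (sBar X)
    (fun b hb h => sBar_eq_zero hb h) (hr.symm ▸ disjoint_LBar_NBar n)
    (hr.symm ▸ LBar_sup_NBar n)

variable (X) in
/-- The differential `B̄^L_{n+1} → B̄^L_n`. -/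
noncomputable def dLBar (n : ℕ) : LBar X (n + 1) →ₗ[Env X] LBar X n :=
  (dBar X).restrict (dBar_LBar n)

lemma exists_rep_QBar {n : ℕ} (q : QBar X n) :
    ∃ b : grBar X n, (b : BBar X) ∈ NBar X n ∧ Submodule.Quotient.mk b = q := by
  obtain ⟨⟨g, hg⟩, rfl⟩ := Submodule.mkQ_surjective _ q
  have hg' := hg
  rw [← DBar_sup_NBar] at hg'
  obtain ⟨a, ha, b, hb, rfl⟩ := Submodule.mem_sup.1 hg'
  refine ⟨⟨b, NBar_le_grBar n hb⟩, hb, ?_⟩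
  refine (Submodule.Quotient.eq _).2 ?_
  change b - (a + b) ∈ DBar X n
  rw [sub_add_cancel_right]
  exact neg_mem ha

/-- With b in B̄^N representing q, db lies in B̄^N as well and represents the boundary of q. The
explicit formula thus applies on both sides, and ds = -sd yields the sign. -/
lemma dDBar_equiv {Φ : ∀ n : ℕ, (LBar X (n + 2) × QBar X (n + 1)) ≃ₗ[Env X] DBar X (n + 2)}
    (hΦ : ∀ (n : ℕ) (l : LBar X (n + 2)) (b : grBar X (n + 1)), (b : BBar X) ∈ NBar X (n + 1) →
        ((Φ n (l, Submodule.Quotient.mk b) : DBar X (n + 2)) : BBar X) =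
          (l : BBar X) + sBar X (b : BBar X)) (n : ℕ) (l : LBar X (n + 3)) (q : QBar X (n + 2)) :
    dDBar X (n + 2) (Φ (n + 1) (l, q)) = Φ n (dLBar X (n + 2) l, -dQBar X (n + 1) q) := by
  obtain ⟨b, hb, rfl⟩ := exists_rep_QBar q
  have h : -dQBar X (n + 1) (Submodule.Quotient.mk b) =
      Submodule.Quotient.mk (-dGrBar X (n + 1) b) := rfl
  refine Subtype.ext ?_
  rw [h, hΦ n _ _ (neg_mem (dBar_NBar hb))]
  change dBar X ((Φ (n + 1) (l, Submodule.Quotient.mk b) : DBar X (n + 3)) : BBar X) =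
    dBar X (l : BBar X) + sBar X (-dBar X (b : BBar X))
  rw [hΦ (n + 1) l b hb, map_add, dBar_sBar hb, map_neg]

lemma dDBar_one (b : DBar X 2) : dDBar X 1 b = 0 :=
  Subtype.ext ((Submodule.mem_bot (Env X)).1 (DBar_one (X := X) ▸ (dDBar X 1 b).2))

lemma dLBar_one (l : LBar X 2) : dLBar X 1 l = 0 :=
  Subtype.ext ((Submodule.mem_bot (Env X)).1 (LBar_one (X := X) ▸ (dLBar X 1 l).2))

lemma dQBar_zero (q : QBar X 1) : dQBar X 0 q = 0 := by
  obtain ⟨b, rfl⟩ := Submodule.mkQ_surjective _ q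
  have h : dGrBar X 0 b = 0 := Subtype.ext (dBar_grBar_one b.2)
  change Submodule.Quotient.mk (dGrBar X 0 b) = _
  rw [h]
  rfl

end BarComplex

section Rack

variable {X : Type*} [Spindle X]

/-! ### The rack complex and `B̄` -/

lemma eMono_eq_eList {n : ℕ} (x : Fin n → X) : eMono x = eList (List.ofFn x) := by
  rw [eMono, eList, List.map_ofFn]
  rfl

lemma eMono_succ {n : ℕ} (x : Fin (n + 1) → X) :
    eMono x = ge (x 0) * eMono fun i : Fin n => x i.succ := by
  rw [eMono_eq_eList, eMono_eq_eList, List.ofFn_succ, eList_cons]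

lemma face1_zero {n : ℕ} (x : Fin (n + 1) → X) : face1 x 0 = fun i => x i.succ := by
  funext i
  simp [face1]

lemma eMono_face0_succ {n : ℕ} (x : Fin (n + 2) → X) (i : Fin (n + 1)) :
    eMono (face0 x i.succ) = ge (x 0) * eMono (face0 (fun j => x j.succ) i) := by
  rw [eMono_succ]
  congr 2
  funext j
  simp only [face0, Fin.succ_succAbove_succ]

lemma eMono_face1_succ {n : ℕ} (x : Fin (n + 2) → X) (i : Fin (n + 1)) :
    eMono (face1 x i.succ) =
      ge (rop (x 0) (x i.succ)) * eMono (face1 (fun j => x j.succ) i) := by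
  rw [eMono_succ]
  congr 2
  funext j
  simp only [face1, Fin.succ_succAbove_succ, ← Fin.succ_castSucc, Fin.succ_lt_succ_iff]

/-- By the Leibniz rule the i-th letter is replaced by 1 - x_i. Moving x_i to the front acts on the
letters before it, whence `face1`. -/
lemma d_eMono {n : ℕ} (x : Fin (n + 1) → X) :
    d X (eMono x) = ∑ i : Fin (n + 1), (-1 : ℤ) ^ (i : ℕ) •
      (eMono (face0 x i) - gx (x i) * eMono (face1 x i)) := by
  induction n with
  | zero =>
    rw [eMono_succ, d_ge_mul, Fin.sum_univ_one, face0_zero, face1_zero]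
    simp [eMono]
  | succ n ih =>
    rw [eMono_succ, d_ge_mul, ih, Fin.sum_univ_succ (n := n + 1), face0_zero, face1_zero,
      Finset.mul_sum, sub_mul, one_mul, Fin.val_zero, pow_zero, one_smul, sub_eq_add_neg,
      ← Finset.sum_neg_distrib]
    congr 1
    refine Finset.sum_congr rfl fun i _ => ?_
    -- The first letter sits before x_i, and `ge_rel` accounts both for its sign-free passage to the
    -- right of x_i and for its relabelling.
    rw [eMono_face0_succ, eMono_face1_succ, Fin.val_succ, pow_succ, mul_neg_one, neg_smul,
      mul_smul_comm, mul_sub, ← mul_assoc (gx _) (ge _), ge_rel, mul_assoc (ge _)]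

/-- The map `x₁ ⋯ xₙ ↦ e_{x₁} ⋯ e_{xₙ}`. -/
noncomputable def monoHom (n : ℕ) : RC X n →+ B X :=
  Finsupp.liftAddHom fun x => zmultiplesHom (B X) (eMono x)

lemma monoHom_single {n : ℕ} (x : Fin n → X) (r : ℤ) :
    monoHom n (Finsupp.single x r) = r • eMono x := by
  simp [monoHom]

lemma pr_monoHom_bdry {n : ℕ} (c : RC X (n + 1)) :
    pr X (monoHom n (bdry X n c)) = pr X (d X (monoHom (n + 1) c)) := by
  have h : ((pr X).toAddMonoidHom.comp (monoHom n)).comp (bdry X n).toAddMonoidHom =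
      ((pr X).toAddMonoidHom.comp (d X).toAddMonoidHom).comp (monoHom (n + 1)) := by
    refine Finsupp.addHom_ext fun x r => ?_
    change pr X (monoHom n (bdry X n (Finsupp.single x r))) =
      pr X (d X (monoHom (n + 1) (Finsupp.single x r)))
    rw [bdry, Finsupp.linearCombination_single, map_zsmul, monoHom_single, map_zsmul, map_zsmul,
      map_zsmul, d_eMono, map_sum, map_sum, map_sum]
    congr 1
    refine Finset.sum_congr rfl fun i _ => ?_
    rw [map_zsmul, map_zsmul, map_zsmul, map_sub, map_sub, map_sub, monoHom_single,
      monoHom_single, pr_gx_mul, one_smul, one_smul]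
  exact DFunLike.congr_fun h c

variable (X) in
/-- The coefficients of an element of `B̄`, seen on `B`. -/
noncomputable def coeffs : B X →+ (List X →₀ ℤ) :=
  (Finsupp.mapDomain.addMonoidHom Prod.snd : NF X →+ (List X →₀ ℤ)).comp (nf X)

lemma coeffs_bas (m : StrMonoid X) (w : List X) : coeffs X (bas m w) = Finsupp.single w 1 := by
  change Finsupp.mapDomain Prod.snd (nf X (bas m w)) = _
  rw [nf_bas, Finsupp.mapDomain_single]

lemma coeffs_gx_mul (x : X) (b : B X) : coeffs X (gx x * b) = coeffs X b := by
  refine DFunLike.congr_fun (addHom_ext_bas (f := (coeffs X).comp (AddMonoidHom.mulLeft (gx x)))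
    (g := coeffs X) fun m w => ?_) b
  change coeffs X (gx x * bas m w) = _
  rw [gx_mul_bas, coeffs_bas, coeffs_bas]

lemma coeffs_barSub {b : B X} (hb : b ∈ barSub X (B X)) : coeffs X b = 0 := by
  have h : AddSubgroup.closure {t : B X | ∃ (x : X) (m : B X), t = lact (gA x) m - m} ≤
      (coeffs X).ker := by
    refine (AddSubgroup.closure_le _).2 ?_
    rintro _ ⟨x, b, rfl⟩
    change coeffs X _ = 0
    rw [map_sub, lact_B, incl_gA, coeffs_gx_mul, sub_self]
  exact h (mem_closure_of_mem_barSub hb)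

lemma coeffs_monoHom {n : ℕ} (c : RC X n) :
    coeffs X (monoHom n c) = Finsupp.mapDomain List.ofFn c := by
  have h : (coeffs X).comp (monoHom n) =
      (Finsupp.mapDomain.addMonoidHom List.ofFn : RC X n →+ (List X →₀ ℤ)) := by
    refine Finsupp.addHom_ext fun x r => ?_
    change coeffs X (monoHom n (Finsupp.single x r)) = Finsupp.mapDomain _ _
    rw [monoHom_single, map_zsmul, eMono_eq_eList, ← bas_one, coeffs_bas,
      Finsupp.mapDomain_single, Finsupp.smul_single, smul_eq_mul, mul_one]
  exact DFunLike.congr_fun h c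

/-- Forgetting the M(X)-component of normal forms is invariant under left multiplication by x, so it
kills the kernel of B → B̄, and it reads off the tuple as a list. -/
lemma pr_monoHom_injective (n : ℕ) :
    Function.Injective ((pr X).toAddMonoidHom.comp (monoHom n)) := by
  rw [injective_iff_map_eq_zero]
  intro c hc
  have h : coeffs X (monoHom n c) = 0 := coeffs_barSub (pr_eq_zero_iff.1 hc)
  rw [coeffs_monoHom] at h
  exact Finsupp.mapDomain_injective List.ofFn_injective (by rw [h, Finsupp.mapDomain_zero])

/-! ### The subcomplexes `C^D` and `C^L` inside `B̄` -/

/-- The span of the tuples satisfying a given property. -/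
noncomputable def tupleSpan (P : List X → Prop) (n : ℕ) : Submodule ℤ (RC X n) :=
  Submodule.span ℤ {c | ∃ x : Fin n → X, P (List.ofFn x) ∧ c = Finsupp.single x 1}

lemma monoHom_mem_W {P : List X → Prop} {n : ℕ} {c : RC X n} (hc : c ∈ tupleSpan P n) :
    monoHom n c ∈ W fun w => P w ∧ w.length = n := by
  refine Submodule.span_induction
    (p := fun c _ => monoHom n c ∈ W fun w : List X => P w ∧ w.length = n) ?_ ?_ ?_ ?_ hc
  · rintro _ ⟨x, hx, rfl⟩
    rw [monoHom_single, one_smul, eMono_eq_eList, ← bas_one]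
    exact bas_mem_W 1 ⟨hx, List.length_ofFn⟩
  · rw [map_zero]; exact zero_mem _
  · intro a b _ _ ha hb; rw [map_add]; exact add_mem ha hb
  · intro r a _ ha; rw [map_zsmul]; exact zsmul_mem ha r

lemma exists_monoHom_of_mem_W {P : List X → Prop} {n : ℕ} {b : B X}
    (hb : b ∈ W fun w => P w ∧ w.length = n) :
    ∃ c ∈ tupleSpan P n, pr X (monoHom n c) = pr X b := by
  have h : (W fun w : List X => P w ∧ w.length = n) ≤
      ((tupleSpan P n).toAddSubgroup.map ((pr X).toAddMonoidHom.comp (monoHom n))).comap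
        (pr X).toAddMonoidHom := by
    refine W_le ?_
    rintro m w ⟨hw, rfl⟩
    refine ⟨Finsupp.single w.get 1, Submodule.subset_span ⟨w.get, ?_, rfl⟩, ?_⟩
    · rwa [List.ofFn_get]
    · change pr X (monoHom _ (Finsupp.single w.get 1)) = pr X (bas m w)
      rw [monoHom_single, one_smul, eMono_eq_eList, List.ofFn_get, pr_bas]
  exact h hb

/-- For the converse, the class of b comes from some chain in the tuple span, which must be c
because tuples stay independent in B̄. -/
lemma mem_tupleSpan_iff {P : List X → Prop} {n : ℕ} {c : RC X n} :
    c ∈ tupleSpan P n ↔ ∃ b ∈ W fun w => P w ∧ w.length = n, pr X b = pr X (monoHom n c) := by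
  constructor
  · intro hc
    exact ⟨_, monoHom_mem_W hc, rfl⟩
  · rintro ⟨b, hb, h⟩
    obtain ⟨c', hc', h'⟩ := exists_monoHom_of_mem_W hb
    have : c' = c := pr_monoHom_injective n (h'.trans h)
    rwa [← this]

lemma mem_CD_iff {n : ℕ} {c : RC X n} : c ∈ CD X n ↔ pr X (monoHom n c) ∈ DBar X n := by
  have h : CD X n = tupleSpan IsDeg n := by simp only [CD, tupleSpan, isDeg_ofFn]
  rw [h, mem_tupleSpan_iff]
  simp only [← mem_DGr_iff]
  rfl

lemma mem_CL_iff {n : ℕ} {c : RC X n} : c ∈ CL X n ↔ pr X (monoHom n c) ∈ LBar X n := by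
  have h : CL X n = tupleSpan IsLate n := by simp only [CL, tupleSpan, isLate_ofFn]
  rw [h, mem_tupleSpan_iff]
  simp only [← mem_LGr_map_iff]
  rfl

lemma pr_monoHom_mem {n : ℕ} (c : RC X n) : pr X (monoHom n c) ∈ grBar X n := by
  refine ⟨monoHom n c, ?_, rfl⟩
  induction c using Finsupp.induction_linear with
  | zero => rw [map_zero]; exact zero_mem _
  | add a b ha hb => rw [map_add]; exact add_mem ha hb
  | single x r =>
    rw [monoHom_single, eMono_eq_eList]
    have h := eList_mem_gr (List.ofFn x)
    rw [List.length_ofFn] at h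
    exact zsmul_mem h r

/-- The isomorphism between the rack complex and `B̄`. -/
noncomputable def rackEquiv (n : ℕ) : RC X n ≃+ grBar X n :=
  AddEquiv.ofBijective
    (((pr X).toAddMonoidHom.comp (monoHom n)).codRestrict (grBar X n) pr_monoHom_mem) (by
      refine ⟨fun a b h => pr_monoHom_injective n (congrArg Subtype.val h), ?_⟩
      rintro ⟨_, b, hb, rfl⟩
      have hb' : b ∈ W fun w : List X => True ∧ w.length = n := by
        simpa only [true_and] using mem_gr_iff.1 hb
      obtain ⟨c, -, hc⟩ := exists_monoHom_of_mem_W hb'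
      exact ⟨c, Subtype.ext hc⟩)

lemma coe_rackEquiv {n : ℕ} (c : RC X n) :
    (rackEquiv n c : BBar X) = pr X (monoHom n c) := rfl

lemma rackEquiv_bdry {n : ℕ} (c : RC X (n + 1)) :
    rackEquiv n (bdry X n c) = dGrBar X n (rackEquiv (n + 1) c) :=
  Subtype.ext (pr_monoHom_bdry c)

lemma coe_rackEquiv_bdry {n : ℕ} (c : RC X (n + 1)) :
    (rackEquiv n (bdry X n c) : BBar X) = dBar X (rackEquiv (n + 1) c : BBar X) :=
  congrArg Subtype.val (rackEquiv_bdry c)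

lemma rackEquiv_ext {n : ℕ} {a b : RC X n}
    (h : (rackEquiv n a : BBar X) = (rackEquiv n b : BBar X)) : a = b :=
  (rackEquiv n).injective (Subtype.ext h)

lemma bdry_mem_CD (n : ℕ) : (CD X (n + 1)).map (bdry X n) ≤ CD X n := by
  rintro _ ⟨c, hc, rfl⟩
  rw [mem_CD_iff, ← coe_rackEquiv, coe_rackEquiv_bdry]
  exact dBar_DBar n _ (mem_CD_iff.1 hc)

lemma bdry_mem_CL (n : ℕ) : (CL X (n + 1)).map (bdry X n) ≤ CL X n := by
  rintro _ ⟨c, hc, rfl⟩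
  rw [mem_CL_iff, ← coe_rackEquiv, coe_rackEquiv_bdry]
  exact dBar_LBar n _ (mem_CL_iff.1 hc)

/-- The restriction of `rackEquiv` to corresponding submodules. -/
noncomputable def rackEquivSub {n : ℕ} (C : Submodule ℤ (RC X n))
    (S : Submodule (Env X) (BBar X)) (hS : S ≤ grBar X n)
    (h : ∀ c, c ∈ C ↔ (rackEquiv n c : BBar X) ∈ S) : C ≃+ S :=
  AddEquiv.ofBijective
    (AddMonoidHom.mk' (fun c : C => (⟨rackEquiv n (c : RC X n), (h c).1 c.2⟩ : S))
      (fun a b => Subtype.ext (by simp))) (by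
      refine ⟨fun a b hab =>
        Subtype.ext (rackEquiv_ext (congrArg (fun y : S => (y : BBar X)) hab)), ?_⟩
      rintro ⟨y, hy⟩
      obtain ⟨c, hc⟩ := (rackEquiv n).surjective ⟨y, hS hy⟩
      have hc' : (rackEquiv n c : BBar X) = y := congrArg Subtype.val hc
      exact ⟨⟨c, (h c).2 (hc'.symm ▸ hy)⟩, Subtype.ext hc'⟩)

lemma DBar_le_grBar (n : ℕ) : DBar X n ≤ grBar X n := Submodule.map_mono inf_le_right

/-- The isomorphism `C^D ≃ B̄^D`. -/
noncomputable def rackEquivD (n : ℕ) : CD X n ≃+ DBar X n :=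
  rackEquivSub _ _ (DBar_le_grBar n) fun _ => mem_CD_iff

/-- The isomorphism `C^L ≃ B̄^L`. -/
noncomputable def rackEquivL (n : ℕ) : CL X n ≃+ LBar X n :=
  rackEquivSub _ _ ((LBar_le_DBar n).trans (DBar_le_grBar n)) fun _ => mem_CL_iff

/-- The isomorphism `C^Q ≃ B̄^Q`. -/
noncomputable def rackEquivQ (n : ℕ) : CQ X n ≃+ QBar X n :=
  QuotientAddGroup.congr (CD X n).toAddSubgroup ((DBar X n).submoduleOf (grBar X n)).toAddSubgroup
    (rackEquiv n) (by
      ext y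
      constructor
      · rintro ⟨c, hc, rfl⟩
        exact mem_CD_iff.1 hc
      · intro hy
        obtain ⟨c, rfl⟩ := (rackEquiv n).surjective y
        exact ⟨c, mem_CD_iff.2 hy, rfl⟩)

/-! ### Transport of the decomposition to the rack complex -/

lemma rackEquivQ_mk {n : ℕ} (c : RC X n) :
    rackEquivQ n (Submodule.Quotient.mk c) = Submodule.Quotient.mk (rackEquiv n c) := rfl

/-- The decomposition of `B̄^D` transported to the rack complex. -/
noncomputable def rackDecomp {n : ℕ}
    (Φ : (LBar X (n + 2) × QBar X (n + 1)) ≃ₗ[Env X] DBar X (n + 2)) :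
    (CL X (n + 2) × CQ X (n + 1)) ≃ₗ[ℤ] CD X (n + 2) :=
  ((((rackEquivL (n + 2)).prodCongr (rackEquivQ (n + 1))).trans
    Φ.toAddEquiv).trans (rackEquivD (n + 2)).symm).toIntLinearEquiv

lemma coe_rackDecomp {n : ℕ} (Φ : (LBar X (n + 2) × QBar X (n + 1)) ≃ₗ[Env X] DBar X (n + 2))
    (l : CL X (n + 2)) (q : CQ X (n + 1)) :
    ((rackEquiv (n + 2) (rackDecomp Φ (l, q) : CD X (n + 2)) : grBar X (n + 2)) : BBar X) =
      (Φ (rackEquivL (n + 2) l, rackEquivQ (n + 1) q) : DBar X (n + 2)) := by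
  have h : rackEquivD (n + 2) (rackDecomp Φ (l, q)) =
      Φ (rackEquivL (n + 2) l, rackEquivQ (n + 1) q) := (rackEquivD (n + 2)).apply_symm_apply _
  exact congrArg Subtype.val h

end Rack

end ShelfBialg

theorem mainTheorem7 (X : Type*) [Spindle X] :
    -- the degeneracy `s` is an injective map `B⁺ → B^D` of degree `1`
    ((∀ n, ∀ b ∈ gr X (n + 1), s X b ∈ DGr X (n + 2)) ∧
      (∀ b ∈ pos X, s X b ∈ degen X) ∧
      Set.InjOn (s X) (pos X : Set (B X))) ∧
    -- multiplication identifies `B^L` with the graded sub-bimodule `B⁺ B^D` of `B^D`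
    (Function.Injective (mulMap X) ∧
      LinearMap.range (mulMap X) =
        Submodule.span (Env X) {t | ∃ b ∈ pos X, ∃ c ∈ degen X, t = b * c} ∧
      LinearMap.range (mulMap X) ≤ degen X ∧
      (∀ n, (LGr X n).map (mulMap X) = LinearMap.range (mulMap X) ⊓ gr X n)) ∧
    -- the internal decomposition `B^D = B^L ⊕ s((B^N)⁺)`, globally and in each degree
    (Disjoint (LinearMap.range (mulMap X)) ((BN X ⊓ pos X).map (s X)) ∧
      LinearMap.range (mulMap X) ⊔ (BN X ⊓ pos X).map (s X) = degen X ∧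
      DGr X 0 = ⊥ ∧ DGr X 1 = ⊥ ∧
      (∀ n, Disjoint ((LGr X (n + 2)).map (mulMap X)) ((NGr X (n + 1)).map (s X)) ∧
        (LGr X (n + 2)).map (mulMap X) ⊔ (NGr X (n + 1)).map (s X) = DGr X (n + 2))) ∧
    -- `B^D_n ≃ B^L_n ⊕ B^Q_{n-1}` as bimodules for `n ≥ 2`
    (∃ Φ : ∀ n : ℕ, (LGr X (n + 2) × QGr X (n + 1)) ≃ₗ[Env X] DGr X (n + 2),
      ∀ (n : ℕ) (l : LGr X (n + 2)) (b : gr X (n + 1)), (b : B X) ∈ BN X →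
        ((Φ n (l, Submodule.Quotient.mk b) : DGr X (n + 2)) : B X) =
          mulMap X (l : BL X) + s X (b : B X)) ∧
    -- in `B̄`: the functor `M ↦ M̄` applied to `B^L → B` and `B^D → B` gives injections,
    -- and `B̄^L` and `s((B̄^N)⁺)` are stable under the differential
    (Function.Injective (barMap (mulMap X)) ∧
      Function.Injective (barMap (degen X).subtype) ∧
      (∀ n, (LBar X (n + 1)).map (dBar X) ≤ LBar X n) ∧
      (∀ n, ((NBar X (n + 2)).map (sBar X)).map (dBar X) ≤ (NBar X (n + 1)).map (sBar X)) ∧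
      (∀ n, Disjoint (LBar X (n + 2)) ((NBar X (n + 1)).map (sBar X)) ∧
        LBar X (n + 2) ⊔ (NBar X (n + 1)).map (sBar X) = DBar X (n + 2))) ∧
    -- `B̄^D_n ≃ B̄^L_n ⊕ B̄^Q_{n-1}` as d.g. bimodules for `n ≥ 2`
    (∃ (Φ : ∀ n : ℕ, (LBar X (n + 2) × QBar X (n + 1)) ≃ₗ[Env X] DBar X (n + 2))
      (dL : ∀ n : ℕ, LBar X (n + 1) →ₗ[Env X] LBar X n),
      (∀ (n : ℕ) (l : LBar X (n + 2)) (b : grBar X (n + 1)), (b : BBar X) ∈ NBar X (n + 1) →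
        ((Φ n (l, Submodule.Quotient.mk b) : DBar X (n + 2)) : BBar X) =
          (l : BBar X) + sBar X (b : BBar X)) ∧
      (∀ (n : ℕ) (l : LBar X (n + 1)), ((dL n l : LBar X n) : BBar X) = dBar X (l : BBar X)) ∧
      (∀ (n : ℕ) (l : LBar X (n + 3)) (q : QBar X (n + 2)),
        dDBar X (n + 2) (Φ (n + 1) (l, q)) = Φ n (dL (n + 2) l, -dQBar X (n + 1) q)) ∧
      (∀ p, dDBar X 1 (Φ 0 p) = 0) ∧
      (∀ l, dL 1 l = 0) ∧
      (∀ q, dQBar X 0 q = 0) ∧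
      -- the rack complex is `B̄`, and the decomposition becomes that of its degenerate part
      (∃ θ : ∀ n : ℕ, RC X n ≃+ grBar X n,
        (∀ (n : ℕ) (x : Fin n → X),
          ((θ n (Finsupp.single x 1) : grBar X n) : BBar X) = pr X (eMono x)) ∧
        (∀ (n : ℕ) (c : RC X (n + 1)), θ n (bdry X n c) = dGrBar X n (θ (n + 1) c)) ∧
        (∀ (n : ℕ) (c : RC X n), c ∈ CD X n ↔ (θ n c : BBar X) ∈ DBar X n) ∧
        (∀ (n : ℕ) (c : RC X n), c ∈ CL X n ↔ (θ n c : BBar X) ∈ LBar X n) ∧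
        (∀ n : ℕ, (CD X (n + 1)).map (bdry X n) ≤ CD X n) ∧
        (∀ n : ℕ, (CL X (n + 1)).map (bdry X n) ≤ CL X n) ∧
        (∃ Ψ : ∀ n : ℕ, (CL X (n + 2) × CQ X (n + 1)) ≃ₗ[ℤ] CD X (n + 2),
          (∀ (n : ℕ) (l : CL X (n + 2)) (c : RC X (n + 1)) (l' : LBar X (n + 2)),
            (l' : BBar X) = θ (n + 2) (l : RC X (n + 2)) →
            ((θ (n + 2) (Ψ n (l, Submodule.Quotient.mk c) : CD X (n + 2)) : grBar X (n + 2)) :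
              BBar X) = (Φ n (l', Submodule.Quotient.mk (θ (n + 1) c)) : DBar X (n + 2))) ∧
          (∀ (n : ℕ) (l : CL X (n + 3)) (c : RC X (n + 2)) (l' : CL X (n + 2)),
            (l' : RC X (n + 2)) = bdry X (n + 2) (l : RC X (n + 3)) →
            bdry X (n + 2) (Ψ (n + 1) (l, Submodule.Quotient.mk c) : CD X (n + 3)) =
              (Ψ n (l', -Submodule.Quotient.mk (bdry X (n + 1) c)) : CD X (n + 2))) ∧
          (∀ p, bdry X 1 (Ψ 0 p : CD X 2) = 0)))) := by
  refine ⟨⟨fun n b hb => s_mem_DGr hb, fun b _ => s_mem_degen b, s_injOn⟩,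
    ⟨mulMap_injective, range_mulMap_eq_span, range_mulMap_le, LGr_map_eq⟩,
    ⟨disjoint_mulMap_s, range_mulMap_sup, DGr_eq_bot (by omega), DGr_eq_bot (by omega),
      fun n => ⟨disjoint_LGr_NGr n, LGr_sup_NGr n⟩⟩, ?_,
    ⟨barMap_mulMap_injective, barMap_degen_injective,
      fun n => Submodule.map_le_iff_le_comap.2 (dBar_LBar n), sBar_NBar_map_dBar,
      fun n => ⟨disjoint_LBar_NBar n, LBar_sup_NBar n⟩⟩, ?_⟩
  · choose Φ hΦ using exists_equiv_DGr (X := X)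
    exact ⟨Φ, hΦ⟩
  · choose Φ hΦ using exists_equiv_DBar (X := X)
    refine ⟨Φ, dLBar X, hΦ, fun _ _ => rfl, dDBar_equiv hΦ, fun p => dDBar_one _, dLBar_one,
      dQBar_zero, rackEquiv, fun n x => ?_, fun n c => rackEquiv_bdry c, fun n c => mem_CD_iff,
      fun n c => mem_CL_iff, bdry_mem_CD, bdry_mem_CL, fun n => rackDecomp (Φ n), ?_, ?_, ?_⟩
    · rw [coe_rackEquiv, monoHom_single, one_smul]
    · intro n l c l' hl'
      obtain rfl : rackEquivL (n + 2) l = l' := Subtype.ext hl'.symm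
      exact coe_rackDecomp (Φ n) l _
    · intro n l c l' hl'
      -- The equality is tested in B̄, where h1 and h2 identify the rack differentials on C^L and
      -- C^Q with those of B̄^L and B̄^Q; the claim becomes `dDBar_equiv`.
      refine rackEquiv_ext ?_
      have h1 : rackEquivL (n + 2) l' = dLBar X (n + 2) (rackEquivL (n + 3) l) := by
        refine Subtype.ext ?_
        change (rackEquiv (n + 2) (l' : RC X (n + 2)) : BBar X) = _
        rw [hl', coe_rackEquiv_bdry]
        rfl
      have h2 : rackEquivQ (n + 1) (-Submodule.Quotient.mk (bdry X (n + 1) c)) =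
          -dQBar X (n + 1) (rackEquivQ (n + 2) (Submodule.Quotient.mk c)) := by
        rw [map_neg, rackEquivQ_mk, rackEquivQ_mk, rackEquiv_bdry]
        rfl
      rw [coe_rackEquiv_bdry, coe_rackDecomp, coe_rackDecomp, h1, h2, ← dDBar_equiv hΦ]
      rfl
    · intro p
      refine rackEquiv_ext ?_
      rw [coe_rackEquiv_bdry, coe_rackDecomp, map_zero]
      exact congrArg Subtype.val (dDBar_one (Φ 0 _))
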